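/- Let $M$ be a compact, oriented, 2-dimensional smooth Riemannian manifold (without boundary, not necessarily connected) with volume form $\mathrm{vol}$ and Riemannian volume measure $dv$, and let $(N,\omega)$ be a symplectic manifold. For a smooth map $\psi:M\to N$ put $$F(\psi)=\frac12\int_M\|\psi^*\omega\|^2\,dv,\qquad \|\alpha\|^2=\sum_{i<j}\alpha(e_i,e_j)^2\ \text{ for a 2-form }\alpha\text{ and an orthonormal basis }(e_i).$$ Let the smooth map $\varphi:M\to N$ be a critical point of $F$, that is, $\frac{d}{dt}F(\varphi_t)\big|_{t=0}=0$ for every smooth variation $\varphi_t$ ($t\in\mathbb R$) of $\varphi=\varphi_0$. Then: 1. $\varphi^*\omega$ is coclosed: $\delta\varphi^*\omega=0$, where $\delta=-{*}d{*}$ is the coderivative on 2-forms of $M$. 2. There is a smooth function $f:M\to\mathbb R$ with $\varphi^*\omega=f\,\mathrm{vol}$; it satisfies $f\,|\nabla f|^2=0$ on $M$ and is locally constant; in particular $f$ is constant if $M$ is connected. 3. $\varphi$ minimizes $F$ in its homotopy class: $F(\varphi)\le F(\psi)$ for every smooth map $\psi:M\to N$ homotopic to $\varphi$. -/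

import Mathlib

open Set Filter Topology MeasureTheory Manifold Bundle
open scoped ContDiff ENNReal

-- A vector space carries its standard charted space structure (and not the same structure as seen
-- through the category of topological spaces, which instance search would find first).
attribute [instance 2000] chartedSpaceSelf

noncomputable section

namespace SymplecticEnergy

/-! ### Tangent spaces, coordinate frames and fields of 2-forms -/

section Basic

variable {m : ℕ} {M : Type*} [TopologicalSpace M] [ChartedSpace (EuclideanSpace ℝ (Fin m)) M]

instance finiteDimensional_tangentSpace (x : M) : FiniteDimensional ℝ (TangentSpace (𝓡 m) x) :=
  inferInstanceAs (FiniteDimensional ℝ (EuclideanSpace ℝ (Fin m)))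

instance fact_finrank_tangentSpace (x : M) :
    Fact (Module.finrank ℝ (TangentSpace (𝓡 m) x) = m) :=
  ⟨(finrank_euclideanSpace_fin : Module.finrank ℝ (EuclideanSpace ℝ (Fin m)) = m)⟩

/-- The derivative at `y` of the inverse of the preferred chart around `x₀`. -/
def chartSymmDeriv (x₀ : M) (y : EuclideanSpace ℝ (Fin m)) :
    EuclideanSpace ℝ (Fin m) →L[ℝ] TangentSpace (𝓡 m) ((extChartAt (𝓡 m) x₀).symm y) :=
  mfderiv (𝓡 m) (𝓡 m) (extChartAt (𝓡 m) x₀).symm y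

variable (m M) in
/-- A (not necessarily continuous) field of alternating 2-forms on the tangent spaces of `M`. -/
abbrev TwoForm : Type _ := ∀ x : M, (TangentSpace (𝓡 m) x) [⋀^Fin 2]→L[ℝ] ℝ

/-- The expression of a 2-form in the preferred chart around `x₀`: its pull-back by the inverse
of the chart (meaningful on the target of the chart). -/
def TwoForm.inChart (α : TwoForm m M) (x₀ : M) (y : EuclideanSpace ℝ (Fin m)) :
    (EuclideanSpace ℝ (Fin m)) [⋀^Fin 2]→L[ℝ] ℝ :=
  (α ((extChartAt (𝓡 m) x₀).symm y)).compContinuousLinearMap (chartSymmDeriv x₀ y)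

variable (m M) in
/-- A symplectic form: a smooth, closed, nondegenerate 2-form. -/
structure SymplecticForm where
  /-- the value of the form at each point -/
  toForm : TwoForm m M
  smooth : ∀ x₀ : M, ContDiffOn ℝ ∞ (toForm.inChart x₀) (extChartAt (𝓡 m) x₀).target
  closed : ∀ x₀ : M, ∀ y ∈ (extChartAt (𝓡 m) x₀).target, extDeriv (toForm.inChart x₀) y = 0
  nondegenerate : ∀ (x : M) (v : TangentSpace (𝓡 m) x), (∀ w, toForm x ![v, w] = 0) → v = 0

variable (m M) in
/-- An orientation of a manifold: an orientation of every tangent space which, read in the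
coordinates of the preferred chart around any point `x₀`, is constant near `x₀`. -/
structure ManifoldOrientation [IsManifold (𝓡 m) ∞ M] where
  /-- the orientation of each tangent space -/
  at' : ∀ x : M, Orientation ℝ (TangentSpace (𝓡 m) x) (Fin m)
  locally_const : ∀ x₀ : M, ∀ᶠ x in 𝓝 x₀,
    ∀ hx : x ∈ (trivializationAt (EuclideanSpace ℝ (Fin m)) (TangentSpace (𝓡 m)) x₀).baseSet,
      Orientation.map (Fin m)
        ((trivializationAt (EuclideanSpace ℝ (Fin m)) (TangentSpace (𝓡 m)) x₀).linearEquivAt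
          ℝ x hx) (at' x) =
      Orientation.map (Fin m)
        ((trivializationAt (EuclideanSpace ℝ (Fin m)) (TangentSpace (𝓡 m)) x₀).linearEquivAt
          ℝ x₀ (FiberBundle.mem_baseSet_trivializationAt' x₀)) (at' x₀)

end Basic

/-! ### Pull-back of 2-forms -/

section Pullback

variable {m n : ℕ} {M N : Type*}
  [TopologicalSpace M] [ChartedSpace (EuclideanSpace ℝ (Fin m)) M]
  [TopologicalSpace N] [ChartedSpace (EuclideanSpace ℝ (Fin n)) N]

/-- The pull-back `φ^*Ω` of a 2-form. -/
def pullback (φ : M → N) (Ω : TwoForm n N) : TwoForm m M :=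
  fun x => (Ω (φ x)).compContinuousLinearMap (mfderiv (𝓡 m) (𝓡 n) φ x)

end Pullback

/-! ### Riemannian notions -/

section Riemannian

variable {m : ℕ} {M : Type*} [TopologicalSpace M] [ChartedSpace (EuclideanSpace ℝ (Fin m)) M]
  [RiemannianBundle (fun x : M => TangentSpace (𝓡 m) x)]

/-- The volume density `√ det (g_ij)` of the metric in the preferred chart around `x₀`. -/
def volumeDensity (x₀ : M) (y : EuclideanSpace ℝ (Fin m)) : ℝ :=
  √(Matrix.gram ℝ (fun i : Fin m => chartSymmDeriv x₀ y (EuclideanSpace.single i 1))).det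

/-- The Riemannian volume on the domain of the preferred chart around `x₀` (extended by zero to
`M`): the image of `√ det (g_ij) dy` under the inverse of the chart. -/
def chartVolume [MeasurableSpace M] (x₀ : M) : Measure M :=
  (((volume : Measure (EuclideanSpace ℝ (Fin m))).restrict
      (extChartAt (𝓡 m) x₀).target).withDensity
        (fun y => ENNReal.ofReal (volumeDensity x₀ y))).map (extChartAt (𝓡 m) x₀).symm

variable (m M) in
/-- The Riemannian volume measure. The measures `chartVolume x₀` agree on overlaps of charts;
their supremum (the least measure above all of them) is the measure they glue to. -/
def riemannianVolume [MeasurableSpace M] : Measure M :=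
  ⨆ x₀ : M, chartVolume (m := m) x₀

/-- The squared norm `∑_{i<j} α(e_i, e_j)^2` of a 2-form at `x`, for an orthonormal basis `e`
of the tangent space. -/
def normSq (α : TwoForm m M) (x : M) : ℝ :=
  ∑ i, ∑ j ∈ Finset.Ioi i,
    (α x ![stdOrthonormalBasis ℝ (TangentSpace (𝓡 m) x) i,
           stdOrthonormalBasis ℝ (TangentSpace (𝓡 m) x) j]) ^ 2

/-- The Riemannian gradient of a function, `⟪∇f, v⟫ = df(v)`. -/
def gradient (f : M → ℝ) (x : M) : TangentSpace (𝓡 m) x :=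
  (InnerProductSpace.toDual ℝ (TangentSpace (𝓡 m) x)).symm (mfderiv (𝓡 m) 𝓘(ℝ, ℝ) f x)

variable {n : ℕ} {N : Type*} [TopologicalSpace N] [ChartedSpace (EuclideanSpace ℝ (Fin n)) N]

/-- The functional `F(φ) = ½ ∫_M ‖φ^*Ω‖² dvol`. -/
def energy [MeasurableSpace M] (Ω : SymplecticForm n N) (φ : M → N) : ℝ :=
  (1 / 2) * ∫ x, normSq (m := m) (pullback φ Ω.toForm) x ∂(riemannianVolume m M)

/-- A smooth map `φ` is a critical point of `F` if `d/dt F(φ_t) = 0` at `t = 0` for every smooth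
variation `φ_t` of `φ`. -/
def IsCriticalPoint [MeasurableSpace M] (Ω : SymplecticForm n N) (φ : M → N) : Prop :=
  ContMDiff (𝓡 m) (𝓡 n) ∞ φ ∧
    ∀ Φ : ℝ → M → N,
      ContMDiff (𝓘(ℝ, ℝ).prod (𝓡 m)) (𝓡 n) ∞ (fun p : ℝ × M => Φ p.1 p.2) →
      Φ 0 = φ → HasDerivAt (fun t => energy (m := m) Ω (Φ t)) 0 0

end Riemannian

/-! ### Hodge theory on an oriented Riemannian surface -/

section Surface

variable {M : Type*} [TopologicalSpace M] [ChartedSpace (EuclideanSpace ℝ (Fin 2)) M]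
  [IsManifold (𝓡 2) ∞ M] [RiemannianBundle (fun x : M => TangentSpace (𝓡 2) x)]

/-- The Hodge star of a 2-form on an oriented surface: its value on a positively oriented
orthonormal basis. -/
def hodgeStarTwo (o : ManifoldOrientation 2 M) (α : TwoForm 2 M) (x : M) : ℝ :=
  α x ((o.at' x).finOrthonormalBasis two_pos Fact.out)

/-- The Hodge star of a 1-form on an oriented surface, `(∗β)(v) = -β(Jv)` with `J` the rotation
by a positive right angle; so `∗e¹ = e²` and `∗e² = -e¹` for the coframe dual to a positively
oriented orthonormal basis. -/
def hodgeStarOne (o : ManifoldOrientation 2 M) (β : ∀ x : M, TangentSpace (𝓡 2) x →L[ℝ] ℝ)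
    (x : M) : TangentSpace (𝓡 2) x →L[ℝ] ℝ :=
  -(β x).comp ((o.at' x).rightAngleRotation : TangentSpace (𝓡 2) x →L[ℝ] TangentSpace (𝓡 2) x)

/-- The coderivative `δα = -∗d∗α` of a 2-form on an oriented surface. -/
def coderivative (o : ManifoldOrientation 2 M) (α : TwoForm 2 M) (x : M) :
    TangentSpace (𝓡 2) x →L[ℝ] ℝ :=
  -hodgeStarOne o (fun x => mfderiv (𝓡 2) 𝓘(ℝ, ℝ) (hodgeStarTwo o α) x) x

/-- A 2-form is coclosed if its coderivative vanishes. -/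
def IsCoclosed (o : ManifoldOrientation 2 M) (α : TwoForm 2 M) : Prop :=
  ∀ x, coderivative o α x = 0

end Surface

end SymplecticEnergy

end

/-! Write `ψ^*ω = k vol` with `k = pullbackCoeff o Ω ψ`. In dimension two the pull-back has only
this one coefficient, so `F(ψ) = ½ ∫ k²`.

Criticality. Since `ω` is closed, Cartan's formula makes the derivative of `u^*ω` along a field `w`
the exterior derivative of the 1-form `ω(w, du ·)` (`fderiv_contr_sub_fderiv_contr`). Integrating by
parts in a chart turns the first variation of `F` into an integral of `dk` against this 1-form
(`hasDerivAt_energy`). Bump fields localise it, and `eulerLagrange` says that `∂₁k ∂₀φ - ∂₀k ∂₁φ` is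
`ω`-orthogonal to every vector, hence zero by nondegeneracy. Pairing this vector with `∂₁φ` and
`∂₀φ` gives `∂ᵢk · ω(∂₀φ, ∂₁φ) = 0`, that is `k dk = 0`. Thus `k²` is locally constant, and by
continuity so is `k` (`IsCriticalPoint.isLocallyConstant`). Claims 1 and 2 are immediate from `dk =
0`.

Minimality. For a locally constant weight `f`, the integral `∫ f ψ^*ω` depends only on the homotopy
class of `ψ` (`integral_eq_of_homotopic`). With `f = k_φ` this gives `∫ k_φ² = ∫ k_φ k_ψ`, and `0 ≤
∫ (k_φ - k_ψ)²` then yields `F(φ) ≤ F(ψ)`.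

The homotopy is only continuous, and it is never smoothed. Moving a smooth map inside a single chart
preserves the integral, by Cartan's formula with `df = 0`. Two smooth maps close to a common
continuous map are joined by finitely many such moves (`eventually_integral_eq`). Smooth maps are
dense in `C(M, N)` (`dense_contMDiff`), so the integral extends to a locally constant function on
`C(M, N)`, which is constant along the path given by the homotopy (`eq_of_path_of_dense`). -/

noncomputable section

set_option synthInstance.maxHeartbeats 200000

namespace SymplecticEnergy

/-! ### Alternating 2-forms as bilinear maps. -/

section Bilinear

variable {G : Type*} [NormedAddCommGroup G] [NormedSpace ℝ G]

variable (G) in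
/-- A 2-form on a normed space, regarded as a bilinear map. -/
def toBilin : (G [⋀^Fin 2]→L[ℝ] ℝ) →L[ℝ] G →L[ℝ] G →L[ℝ] ℝ :=
  (ContinuousLinearMap.compL ℝ G (G [×1]→L[ℝ] ℝ) (G →L[ℝ] ℝ)
      (continuousMultilinearCurryFin1 ℝ G ℝ).toContinuousLinearEquiv.toContinuousLinearMap) ∘L
    (continuousMultilinearCurryLeftEquiv ℝ
      (fun _ : Fin 2 => G) ℝ).toContinuousLinearEquiv.toContinuousLinearMap ∘L
    ContinuousAlternatingMap.toContinuousMultilinearMapCLM ℝ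

theorem toBilin_apply (α : G [⋀^Fin 2]→L[ℝ] ℝ) (a b : G) : toBilin G α a b = α ![a, b] := by
  change α (Fin.cons a (Fin.snoc 0 b)) = _
  congr 1
  ext i
  fin_cases i
  · rfl
  · rfl

theorem alternating_swap {V : Type*} [AddCommGroup V] [Module ℝ V] [TopologicalSpace V]
    (α : V [⋀^Fin 2]→L[ℝ] ℝ) (a b : V) : α ![a, b] = -α ![b, a] := by
  have := α.toAlternatingMap.map_swap ![b, a] (i := 0) (j := 1) (by decide)
  have h2 : (![b, a] ∘ Equiv.swap (0 : Fin 2) 1) = ![a, b] := by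
    ext i; fin_cases i <;> simp
  rw [h2] at this
  exact this

theorem toBilin_swap (α : G [⋀^Fin 2]→L[ℝ] ℝ) (a b : G) :
    toBilin G α a b = -toBilin G α b a := by
  rw [toBilin_apply, toBilin_apply, alternating_swap]

/-- The exterior derivative on three vectors is the alternating sum over the vector used for
differentiation, and the linear map `toBilin` commutes with differentiation. -/
theorem closed_toBilin {η : G → G [⋀^Fin 2]→L[ℝ] ℝ} {z : G} (hη : DifferentiableAt ℝ η z)
    (h : extDeriv η z = 0) (a b c : G) :
    fderiv ℝ (fun z => toBilin G (η z)) z a b c - fderiv ℝ (fun z => toBilin G (η z)) z b a c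
      + fderiv ℝ (fun z => toBilin G (η z)) z c a b = 0 := by
  have hd : ∀ v, fderiv ℝ (fun z => toBilin G (η z)) z v = toBilin G (fderiv ℝ η z v) := by
    intro v
    have h0 : HasFDerivAt (fun α => toBilin G α) (toBilin G) (η z) :=
      ContinuousLinearMap.hasFDerivAt (F := G →L[ℝ] G →L[ℝ] ℝ) (toBilin G)
    have h1 := (HasFDerivAt.comp (g := fun α => toBilin G α) z h0 hη.hasFDerivAt).fderiv
    change fderiv ℝ ((fun α => toBilin G α) ∘ η) z v = _
    rw [h1]
    rfl
  have h3 : extDeriv η z ![a, b, c] = 0 := by rw [h]; rfl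
  rw [extDeriv, ContinuousAlternatingMap.alternatizeUncurryFin_apply] at h3
  simp only [hd, toBilin_apply]
  rw [Fin.sum_univ_three] at h3
  have e0 : (0 : Fin 3).removeNth ![a, b, c] = ![b, c] := by
    ext i; fin_cases i <;> rfl
  have e1 : (1 : Fin 3).removeNth ![a, b, c] = ![a, c] := by
    ext i; fin_cases i <;> rfl
  have e2 : (2 : Fin 3).removeNth ![a, b, c] = ![a, b] := by
    ext i; fin_cases i <;> rfl
  rw [e0, e1, e2] at h3
  simp at h3
  linarith

end Bilinear

/-! ### Pull-back coefficients in vector spaces and Cartan's formula. -/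

section Density

variable {E G : Type*} [NormedAddCommGroup E] [NormedSpace ℝ E]
  [NormedAddCommGroup G] [NormedSpace ℝ G]

/-- The coefficient on `(e₁, e₂)` of the pull-back of the 2-form `B` by `u`. -/
def dens (B : G → G →L[ℝ] G →L[ℝ] ℝ) (e₁ e₂ : E) (u : E → G) (y : E) : ℝ :=
  B (u y) (fderiv ℝ u y e₁) (fderiv ℝ u y e₂)

/-- The coefficient on `e` of the pull-back by `u` of the contraction of `B` with the field `w`. -/
def contr (B : G → G →L[ℝ] G →L[ℝ] ℝ) (u w : E → G) (e : E) (y : E) : ℝ :=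
  B (u y) (w y) (fderiv ℝ u y e)

/-- The derivative of `dens` in the direction of the variation field `w`. -/
def densDeriv (B : G → G →L[ℝ] G →L[ℝ] ℝ) (e₁ e₂ : E) (u w : E → G) (y : E) : ℝ :=
  fderiv ℝ B (u y) (w y) (fderiv ℝ u y e₁) (fderiv ℝ u y e₂)
    + B (u y) (fderiv ℝ w y e₁) (fderiv ℝ u y e₂) + B (u y) (fderiv ℝ u y e₁) (fderiv ℝ w y e₂)

variable {B : G → G →L[ℝ] G →L[ℝ] ℝ} {e₁ e₂ : E} {u w : E → G} {y : E}

theorem fderiv_variation (hu : DifferentiableAt ℝ u y) (hw : DifferentiableAt ℝ w y) (s : ℝ) :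
    fderiv ℝ (fun y => u y + s • w y) y = fderiv ℝ u y + s • fderiv ℝ w y :=
  (hu.hasFDerivAt.add (hw.hasFDerivAt.const_smul s)).fderiv

theorem hasDerivAt_dens (hu : DifferentiableAt ℝ u y) (hw : DifferentiableAt ℝ w y) {s : ℝ}
    (hB : DifferentiableAt ℝ B (u y + s • w y)) :
    HasDerivAt (fun s => dens B e₁ e₂ (fun y => u y + s • w y) y)
      (densDeriv B e₁ e₂ (fun y => u y + s • w y) w y) s := by
  simp only [dens, densDeriv, fderiv_variation hu hw]
  have h0 : ∀ a b : G, HasDerivAt (fun s : ℝ => a + s • b) b s := fun a b => by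
    simpa using ((hasDerivAt_id s).smul_const b).const_add a
  have h1 := HasFDerivAt.comp_hasDerivAt (l := B) s hB.hasFDerivAt (h0 (u y) (w y))
  have h2 := h1.clm_apply (h0 (fderiv ℝ u y e₁) (fderiv ℝ w y e₁))
  have h3 := h2.clm_apply (h0 (fderiv ℝ u y e₂) (fderiv ℝ w y e₂))
  refine h3.congr_deriv ?_
  simp

/-- Product rule. The last term contains the Hessian of `u`; it is symmetric in `e` and `v`, so it
disappears in Cartan's formula. -/
theorem fderiv_contr_apply (hu : ContDiffAt ℝ 2 u y) (hw : DifferentiableAt ℝ w y)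
    (hB : DifferentiableAt ℝ B (u y)) (e v : E) :
    fderiv ℝ (contr B u w e) y v =
      fderiv ℝ B (u y) (fderiv ℝ u y v) (w y) (fderiv ℝ u y e)
        + B (u y) (fderiv ℝ w y v) (fderiv ℝ u y e)
        + B (u y) (w y) (fderiv ℝ (fderiv ℝ u) y v e) := by
  have hu1 : DifferentiableAt ℝ u y := hu.differentiableAt (by norm_num)
  have hu2 : DifferentiableAt ℝ (fderiv ℝ u) y :=
    (hu.fderiv_right (m := 1) (by norm_num)).differentiableAt (by norm_num)
  have h1 := HasFDerivAt.comp (g := B) y hB.hasFDerivAt hu1.hasFDerivAt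
  have h2 := h1.clm_apply hw.hasFDerivAt
  have h3 := h2.clm_apply (hu2.hasFDerivAt.clm_apply (hasFDerivAt_const e y))
  have h4 := h3.fderiv
  have h5 : contr B u w e = fun y => (((B ∘ u) y) (w y)) (fderiv ℝ u y e) := rfl
  rw [h5, h4]
  simp
  ring

/-- Cartan's formula: the derivative of the pull-back of a closed form is exact. -/
theorem fderiv_contr_sub_fderiv_contr (hu : ContDiffAt ℝ 2 u y) (hw : DifferentiableAt ℝ w y)
    (hB : DifferentiableAt ℝ B (u y)) (hanti : ∀ a b, B (u y) a b = -B (u y) b a)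
    (hclosed : ∀ a b c, fderiv ℝ B (u y) a b c - fderiv ℝ B (u y) b a c
      + fderiv ℝ B (u y) c a b = 0) :
    fderiv ℝ (contr B u w e₂) y e₁ - fderiv ℝ (contr B u w e₁) y e₂ =
      densDeriv B e₁ e₂ u w y := by
  rw [fderiv_contr_apply hu hw hB, fderiv_contr_apply hu hw hB, densDeriv]
  have hs : fderiv ℝ (fderiv ℝ u) y e₁ e₂ = fderiv ℝ (fderiv ℝ u) y e₂ e₁ :=
    (hu.isSymmSndFDerivAt (by simp)).eq e₁ e₂
  -- Closedness on `(w, ∂₁u, ∂₂u)` trades the two derivatives of `B` along `∂₁u` and `∂₂u` for the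
  -- single one along `w`.
  have h1 := hclosed (w y) (fderiv ℝ u y e₁) (fderiv ℝ u y e₂)
  rw [hs, hanti (fderiv ℝ u y e₁) (fderiv ℝ w y e₂)]
  linarith

end Density

/-! ### Regularity of compactly supported variations in coordinates. -/

section LocalVariation

variable {E G : Type*} [NormedAddCommGroup E] [NormedSpace ℝ E]
  [NormedAddCommGroup G] [NormedSpace ℝ G]

/-- A closed 2-form `B` on the open set `U`, and a variation `u + s w`, `|s| < δ`, of a map
`u : V → U`, with `w` supported in the compact set `K`. -/
structure LocalVariation (B : G → G →L[ℝ] G →L[ℝ] ℝ) (U : Set G) (u w : E → G) (V K : Set E)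
    (δ : ℝ) : Prop where
  isOpen_target : IsOpen U
  isOpen_source : IsOpen V
  isCompact : IsCompact K
  subset : K ⊆ V
  contDiffOn_form : ContDiffOn ℝ ∞ B U
  anti : ∀ z ∈ U, ∀ a b, B z a b = -B z b a
  closed : ∀ z ∈ U, ∀ a b c, fderiv ℝ B z a b c - fderiv ℝ B z b a c + fderiv ℝ B z c a b = 0
  contDiffOn : ContDiffOn ℝ ∞ u V
  contDiffOn_field : ContDiffOn ℝ ∞ w V
  field_eq_zero : ∀ y ∈ V \ K, w y = 0
  mem : ∀ y ∈ V, ∀ s ∈ Ioo (-δ) δ, u y + s • w y ∈ U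

namespace LocalVariation

variable {B : G → G →L[ℝ] G →L[ℝ] ℝ} {U : Set G} {e₁ e₂ : E} {u w : E → G} {V K : Set E} {δ : ℝ}

theorem contDiffOn_variation (h : LocalVariation B U u w V K δ) (s : ℝ) :
    ContDiffOn ℝ ∞ (fun y => u y + s • w y) V :=
  h.contDiffOn.add (h.contDiffOn_field.const_smul s)

theorem differentiableAt (h : LocalVariation B U u w V K δ) {y : E} (hy : y ∈ V) :
    DifferentiableAt ℝ u y :=
  (h.contDiffOn.contDiffAt (h.isOpen_source.mem_nhds hy)).differentiableAt (by simp)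

theorem differentiableAt_field (h : LocalVariation B U u w V K δ) {y : E} (hy : y ∈ V) :
    DifferentiableAt ℝ w y :=
  (h.contDiffOn_field.contDiffAt (h.isOpen_source.mem_nhds hy)).differentiableAt (by simp)

theorem differentiableAt_form (h : LocalVariation B U u w V K δ) {z : G} (hz : z ∈ U) :
    DifferentiableAt ℝ B z :=
  (h.contDiffOn_form.contDiffAt (h.isOpen_target.mem_nhds hz)).differentiableAt (by simp)

theorem hasDerivAt (h : LocalVariation B U u w V K δ) {y : E} (hy : y ∈ V) {s : ℝ}
    (hs : s ∈ Ioo (-δ) δ) :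
    HasDerivAt (fun s => dens B e₁ e₂ (fun y => u y + s • w y) y)
      (densDeriv B e₁ e₂ (fun y => u y + s • w y) w y) s :=
  hasDerivAt_dens (h.differentiableAt hy) (h.differentiableAt_field hy)
    (h.differentiableAt_form (h.mem y hy s hs))

/-- Cartan's formula at every parameter `s`: the first variation needs only `s = 0`, but the
constancy of weighted integrals along a chart move needs the whole interval. -/
theorem densDeriv_eq (h : LocalVariation B U u w V K δ) {y : E} (hy : y ∈ V) {s : ℝ}
    (hs : s ∈ Ioo (-δ) δ) :
    densDeriv B e₁ e₂ (fun y => u y + s • w y) w y =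
      fderiv ℝ (contr B (fun y => u y + s • w y) w e₂) y e₁
        - fderiv ℝ (contr B (fun y => u y + s • w y) w e₁) y e₂ := by
  have hz := h.mem y hy s hs
  refine (fderiv_contr_sub_fderiv_contr ?_ (h.differentiableAt_field hy)
    (h.differentiableAt_form hz) (h.anti _ hz) (h.closed _ hz)).symm
  exact (((h.contDiffOn_variation s).contDiffAt (h.isOpen_source.mem_nhds hy)).of_le
    (WithTop.coe_le_coe.2 le_top))

theorem contDiffOn_contr (h : LocalVariation B U u w V K δ) {s : ℝ}
    (hs : s ∈ Ioo (-δ) δ) (e : E) :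
    ContDiffOn ℝ ∞ (contr B (fun y => u y + s • w y) w e) V := by
  have h1 : ContDiffOn ℝ ∞ (fun y => B (u y + s • w y)) V :=
    h.contDiffOn_form.comp (h.contDiffOn_variation s) fun y hy => h.mem y hy s hs
  exact (h1.clm_apply h.contDiffOn_field).clm_apply
    (((h.contDiffOn_variation s).fderiv_of_isOpen h.isOpen_source (by simp)).clm_apply
      contDiffOn_const)

theorem continuousOn_variation (h : LocalVariation B U u w V K δ) :
    ContinuousOn (fun p : ℝ × E => u p.2 + p.1 • w p.2) (Ioo (-δ) δ ×ˢ V) := by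
  have hV : MapsTo Prod.snd (Ioo (-δ) δ ×ˢ V) V := fun p hp => hp.2
  exact (h.contDiffOn.continuousOn.comp continuousOn_snd hV).add
    (continuousOn_fst.smul (h.contDiffOn_field.continuousOn.comp continuousOn_snd hV))

theorem continuousOn_fderiv_variation (h : LocalVariation B U u w V K δ) (e : E) :
    ContinuousOn (fun p : ℝ × E => fderiv ℝ (fun y => u y + p.1 • w y) p.2 e)
      (Ioo (-δ) δ ×ˢ V) := by
  have hV : MapsTo Prod.snd (Ioo (-δ) δ ×ˢ V) V := fun p hp => hp.2
  have hu := (h.contDiffOn.continuousOn_fderiv_of_isOpen h.isOpen_source (by simp)).comp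
    continuousOn_snd hV
  have hw := (h.contDiffOn_field.continuousOn_fderiv_of_isOpen h.isOpen_source (by simp)).comp
    continuousOn_snd hV
  refine ContinuousOn.congr (f := fun p : ℝ × E =>
    (fderiv ℝ u p.2 + p.1 • fderiv ℝ w p.2) e) ?_ ?_
  · exact (hu.add (continuousOn_fst.smul hw)).clm_apply continuousOn_const
  · intro p hp
    simp only [fderiv_variation (h.differentiableAt hp.2) (h.differentiableAt_field hp.2)]

theorem continuousOn_dens (h : LocalVariation B U u w V K δ) :
    ContinuousOn (fun p : ℝ × E => dens B e₁ e₂ (fun y => u y + p.1 • w y) p.2)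
      (Ioo (-δ) δ ×ˢ V) := by
  have h1 := h.contDiffOn_form.continuousOn.comp h.continuousOn_variation
    fun p hp => h.mem _ hp.2 _ hp.1
  exact (h1.clm_apply (h.continuousOn_fderiv_variation e₁)).clm_apply
    (h.continuousOn_fderiv_variation e₂)

theorem continuousOn_densDeriv (h : LocalVariation B U u w V K δ) :
    ContinuousOn (fun p : ℝ × E => densDeriv B e₁ e₂ (fun y => u y + p.1 • w y) w p.2)
      (Ioo (-δ) δ ×ˢ V) := by
  have hV : MapsTo Prod.snd (Ioo (-δ) δ ×ˢ V) V := fun p hp => hp.2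
  have h1 := h.contDiffOn_form.continuousOn.comp h.continuousOn_variation
    fun p hp => h.mem _ hp.2 _ hp.1
  have h2 := (h.contDiffOn_form.continuousOn_fderiv_of_isOpen h.isOpen_target (by simp)).comp
    h.continuousOn_variation fun p hp => h.mem _ hp.2 _ hp.1
  have hw := h.contDiffOn_field.continuousOn.comp continuousOn_snd hV
  have hw' := (h.contDiffOn_field.continuousOn_fderiv_of_isOpen h.isOpen_source (by simp)).comp
    continuousOn_snd hV
  have d1 := h.continuousOn_fderiv_variation e₁
  have d2 := h.continuousOn_fderiv_variation e₂
  exact ((((h2.clm_apply hw).clm_apply d1).clm_apply d2).add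
    ((h1.clm_apply (hw'.clm_apply continuousOn_const)).clm_apply d2)).add
    ((h1.clm_apply d1).clm_apply (hw'.clm_apply continuousOn_const))

end LocalVariation

end LocalVariation

/-! ### Differentiation under the integral and integration by parts. -/

section Integration

/-- Differentiation under an integral over a compact set. -/
theorem hasDerivAt_setIntegral_of_continuousOn {E : Type*} [TopologicalSpace E] [T2Space E]
    [MeasurableSpace E] [BorelSpace E] {μ : Measure E} [IsFiniteMeasureOnCompacts μ]
    {K : Set E} (hK : IsCompact K) {J : Set ℝ} (hJ : IsOpen J) {F F' : ℝ → E → ℝ}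
    (hF : ContinuousOn (Function.uncurry F) (J ×ˢ K))
    (hF' : ContinuousOn (Function.uncurry F') (J ×ˢ K))
    (hd : ∀ s ∈ J, ∀ y ∈ K, HasDerivAt (fun s => F s y) (F' s y) s) {s : ℝ} (hs : s ∈ J) :
    HasDerivAt (fun s => ∫ y in K, F s y ∂μ) (∫ y in K, F' s y ∂μ) s := by
  -- On the compact product of a closed ball around `s` with `K`, the derivative `F'` is bounded;
  -- this constant is the dominating function.
  obtain ⟨r, hr, hrJ⟩ := Metric.nhds_basis_closedBall.mem_iff.1 (hJ.mem_nhds hs)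
  obtain ⟨C, hC⟩ := ((isCompact_closedBall s r).prod hK).exists_bound_of_continuousOn
    (hF'.mono (prod_mono_left hrJ))
  have slice : ∀ {H : ℝ → E → ℝ}, ContinuousOn (Function.uncurry H) (J ×ˢ K) → ∀ t ∈ J,
      ContinuousOn (H t) K := fun {H} hH t ht =>
    hH.comp (f := fun y => (t, y)) (by fun_prop) fun y hy => ⟨ht, hy⟩
  have hKm := hK.measurableSet
  refine (hasDerivAt_integral_of_dominated_loc_of_deriv_le (F := F) (F' := F')
    (bound := fun _ => C) (Metric.closedBall_mem_nhds s hr) ?_ ?_ ?_ ?_ ?_ ?_).2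
  · filter_upwards [hJ.mem_nhds hs] with t ht
    exact ((slice hF t ht).integrableOn_compact hK).aestronglyMeasurable
  · exact (slice hF s hs).integrableOn_compact hK
  · exact ((slice hF' s hs).integrableOn_compact hK).aestronglyMeasurable
  · refine (ae_restrict_iff' hKm).2 (Eventually.of_forall fun y hy t ht => hC (t, y) ⟨ht, hy⟩)
  · exact integrableOn_const hK.measure_ne_top
  · exact (ae_restrict_iff' hKm).2 (Eventually.of_forall fun y hy t ht => hd t (hrJ ht) y hy)

variable {E : Type*} [NormedAddCommGroup E] [NormedSpace ℝ E] [FiniteDimensional ℝ E]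
  [MeasurableSpace E] [BorelSpace E] {μ : Measure E} [μ.IsAddHaarMeasure]

/-- The integral of a derivative of a compactly supported function vanishes. -/
theorem setIntegral_fderiv_eq_zero {g : E → ℝ} {V K : Set E} (hV : IsOpen V) (hK : IsCompact K)
    (hKV : K ⊆ V) (hg : ContDiffOn ℝ 1 g V) (h0 : ∀ y ∈ V \ K, g y = 0) (v : E) :
    ∫ y in K, fderiv ℝ g y v ∂μ = 0 := by
  -- Extension by zero is globally `C¹`, because `V` and the complement of `K` are open, cover the
  -- space, and `g` vanishes on their overlap.
  set f : E → ℝ := V.indicator g with hf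
  have fV : ∀ y ∈ V, f =ᶠ[𝓝 y] g := fun y hy => by
    filter_upwards [hV.mem_nhds hy] with z hz using indicator_of_mem hz g
  have fK : ∀ y ∉ K, f y = 0 := fun y hy => by
    by_cases hyV : y ∈ V
    · rw [hf, indicator_of_mem hyV]; exact h0 y ⟨hyV, hy⟩
    · exact indicator_of_notMem hyV g
  have fK' : ∀ y ∉ K, f =ᶠ[𝓝 y] fun _ => 0 := fun y hy => by
    filter_upwards [hK.isClosed.isOpen_compl.mem_nhds hy] with z hz using fK z hz
  have hfc : ContDiff ℝ 1 f := contDiff_iff_contDiffAt.2 fun y => by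
    by_cases hy : y ∈ K
    · exact (hg.contDiffAt (hV.mem_nhds (hKV hy))).congr_of_eventuallyEq (fV y (hKV hy))
    · exact contDiffAt_const.congr_of_eventuallyEq (fK' y hy)
  have hfs : HasCompactSupport f := HasCompactSupport.intro hK fun y hy => fK y hy
  have i1 : Integrable f μ := hfc.continuous.integrable_of_hasCompactSupport hfs
  have i2 : Integrable (fun y => fderiv ℝ f y v) μ :=
    ((hfc.continuous_fderiv (by simp)).clm_apply continuous_const).integrable_of_hasCompactSupport
      (hfs.fderiv_apply (𝕜 := ℝ) v)
  -- Integration by parts against the constant function 1.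
  have key := integral_mul_fderiv_eq_neg_fderiv_mul_of_integrable (μ := μ)
    (f := fun _ : E => (1 : ℝ))
    (g := f) (v := v) (by simp) (by simpa using i2) (by simpa using i1)
    (fun y _ => differentiableAt_const _) (fun y _ => (hfc.differentiable (by simp)) y)
  have e1 : ∫ y in K, fderiv ℝ g y v ∂μ = ∫ y in K, fderiv ℝ f y v ∂μ :=
    setIntegral_congr_fun hK.measurableSet fun y hy => by
      simp only [(fV y (hKV hy)).fderiv_eq]
  rw [e1, setIntegral_eq_integral_of_forall_compl_eq_zero]
  · simpa using key
  · intro y hy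
    rw [(fK' y hy).fderiv_eq]; simp

namespace LocalVariation

variable {G : Type*} [NormedAddCommGroup G] [NormedSpace ℝ G]
  {B : G → G →L[ℝ] G →L[ℝ] ℝ} {U : Set G} {e₁ e₂ : E} {u w : E → G} {V K : Set E} {δ : ℝ}

/-- By Cartan's formula and Leibniz, the integrand is a combination of derivatives of the products
`F * contr`, plus terms where only `F` is differentiated. The products vanish off `K`, so their
derivatives integrate to zero. What remains is first order in `F` and has no derivative of `w`. -/
theorem setIntegral_mul_densDeriv (h : LocalVariation B U u w V K δ) {F : E → ℝ}
    (hF : ContDiffOn ℝ 1 F V) {s : ℝ} (hs : s ∈ Ioo (-δ) δ) :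
    ∫ y in K, F y * densDeriv B e₁ e₂ (fun y => u y + s • w y) w y ∂μ =
      ∫ y in K, (fderiv ℝ F y e₂ * contr B (fun y => u y + s • w y) w e₁ y
        - fderiv ℝ F y e₁ * contr B (fun y => u y + s • w y) w e₂ y) ∂μ := by
  set A : E → E → ℝ := contr B (fun y => u y + s • w y) w with hA
  have hAc : ∀ e, ContDiffOn ℝ 1 (A e) V := fun e =>
    (h.contDiffOn_contr hs e).of_le (by exact_mod_cast le_top)
  have hA0 : ∀ e, ∀ y ∈ V \ K, (fun y => F y * A e y) y = 0 := fun e y hy => by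
    simp [hA, contr, h.field_eq_zero y hy]
  have z : ∀ e v, ∫ y in K, fderiv ℝ (fun y => F y * A e y) y v ∂μ = 0 := fun e v =>
    setIntegral_fderiv_eq_zero h.isOpen_source h.isCompact h.subset (hF.mul (hAc e)) (hA0 e) v
  have int : ∀ e v, IntegrableOn (fun y => fderiv ℝ (fun y => F y * A e y) y v) K μ := fun e v =>
    ((((hF.mul (hAc e)).continuousOn_fderiv_of_isOpen h.isOpen_source (by simp)).clm_apply
      continuousOn_const).mono h.subset).integrableOn_compact h.isCompact
  have int2 : ∀ e v, IntegrableOn (fun y => fderiv ℝ F y v * A e y) K μ := fun e v =>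
    ((((hF.continuousOn_fderiv_of_isOpen h.isOpen_source (by simp)).clm_apply
      continuousOn_const).mul (hAc e).continuousOn).mono h.subset).integrableOn_compact h.isCompact
  have e : ∀ y ∈ K, F y * densDeriv B e₁ e₂ (fun y => u y + s • w y) w y =
      (fderiv ℝ (fun y => F y * A e₂ y) y e₁ - fderiv ℝ (fun y => F y * A e₁ y) y e₂)
      + (fderiv ℝ F y e₂ * A e₁ y - fderiv ℝ F y e₁ * A e₂ y) := by
    intro y hy
    have hyV := h.isOpen_source.mem_nhds (h.subset hy)
    have dF : DifferentiableAt ℝ F y := (hF.contDiffAt hyV).differentiableAt (by simp)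
    have dA : ∀ e, DifferentiableAt ℝ (A e) y := fun e =>
      ((hAc e).contDiffAt hyV).differentiableAt (by simp)
    rw [h.densDeriv_eq (h.subset hy) hs, fderiv_fun_mul dF (dA _), fderiv_fun_mul dF (dA _)]
    simp [← hA]
    ring
  have i3 := (int e₂ e₁).sub (int e₁ e₂)
  have i4 := (int2 e₁ e₂).sub (int2 e₂ e₁)
  rw [setIntegral_congr_fun h.isCompact.measurableSet e]
  refine (integral_add i3 i4).trans ?_
  have i5 := integral_sub (int e₂ e₁) (int e₁ e₂)
  rw [z, z, sub_zero] at i5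
  refine (congrArg (· + _) i5).trans ?_
  rw [zero_add]
  rfl

omit [FiniteDimensional ℝ E] in
theorem hasDerivAt_setIntegral_mul_dens (h : LocalVariation B U u w V K δ) {F : E → ℝ}
    (hF : ContinuousOn F K) {s : ℝ} (hs : s ∈ Ioo (-δ) δ) :
    HasDerivAt (fun s => ∫ y in K, F y * dens B e₁ e₂ (fun y => u y + s • w y) y ∂μ)
      (∫ y in K, F y * densDeriv B e₁ e₂ (fun y => u y + s • w y) w y ∂μ) s := by
  have hsub : Ioo (-δ) δ ×ˢ K ⊆ Ioo (-δ) δ ×ˢ V := prod_mono_right h.subset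
  have hF2 : ContinuousOn (fun p : ℝ × E => F p.2) (Ioo (-δ) δ ×ˢ K) :=
    hF.comp continuousOn_snd fun p hp => hp.2
  exact hasDerivAt_setIntegral_of_continuousOn h.isCompact isOpen_Ioo
    (F := fun s y => F y * dens B e₁ e₂ (fun y => u y + s • w y) y)
    (F' := fun s y => F y * densDeriv B e₁ e₂ (fun y => u y + s • w y) w y)
    (hF2.mul (h.continuousOn_dens.mono hsub)) (hF2.mul (h.continuousOn_densDeriv.mono hsub))
    (fun t ht y hy => (h.hasDerivAt (h.subset hy) ht).const_mul (F y)) hs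

omit [FiniteDimensional ℝ E] in
theorem hasDerivAt_setIntegral_mul_dens_sq (h : LocalVariation B U u w V K δ) {F : E → ℝ}
    (hF : ContinuousOn F K) {s : ℝ} (hs : s ∈ Ioo (-δ) δ) :
    HasDerivAt (fun s => ∫ y in K, F y * dens B e₁ e₂ (fun y => u y + s • w y) y ^ 2 ∂μ)
      (2 * ∫ y in K, F y * dens B e₁ e₂ (fun y => u y + s • w y) y
        * densDeriv B e₁ e₂ (fun y => u y + s • w y) w y ∂μ) s := by
  have hsub : Ioo (-δ) δ ×ˢ K ⊆ Ioo (-δ) δ ×ˢ V := prod_mono_right h.subset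
  have hF2 : ContinuousOn (fun p : ℝ × E => F p.2) (Ioo (-δ) δ ×ˢ K) :=
    hF.comp continuousOn_snd fun p hp => hp.2
  have h1 := h.continuousOn_dens (e₁ := e₁) (e₂ := e₂) |>.mono hsub
  have h2 := h.continuousOn_densDeriv (e₁ := e₁) (e₂ := e₂) |>.mono hsub
  have h3 : ContinuousOn (fun p : ℝ × E => F p.2 * dens B e₁ e₂ (fun y => u y + p.1 • w y) p.2 ^ 2)
      (Ioo (-δ) δ ×ˢ K) := ContinuousOn.mul hF2 (h1.pow 2)
  have h4 : ContinuousOn (fun p : ℝ × E => 2 * (F p.2 * dens B e₁ e₂ (fun y => u y + p.1 • w y) p.2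
      * densDeriv B e₁ e₂ (fun y => u y + p.1 • w y) w p.2)) (Ioo (-δ) δ ×ˢ K) :=
    ContinuousOn.mul continuousOn_const ((hF2.mul h1).mul h2)
  refine (hasDerivAt_setIntegral_of_continuousOn h.isCompact (isOpen_Ioo (a := -δ) (b := δ))
    (F := fun s y => F y * dens B e₁ e₂ (fun y => u y + s • w y) y ^ 2)
    (F' := fun s y => 2 * (F y * dens B e₁ e₂ (fun y => u y + s • w y) y
        * densDeriv B e₁ e₂ (fun y => u y + s • w y) w y))
    h3 h4
    (fun t ht y hy => ?_) hs).congr_deriv ?_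
  · refine (((h.hasDerivAt (h.subset hy) ht).pow 2).const_mul (F y)).congr_deriv ?_
    simp; ring
  · rw [integral_const_mul]

end LocalVariation

end Integration

/-! ### Coordinate frames and the Riemannian density. -/

section Charts

variable {m : ℕ} {M : Type*} [TopologicalSpace M] [ChartedSpace (EuclideanSpace ℝ (Fin m)) M]

variable [IsManifold (𝓡 m) ∞ M]

variable (m) in
/-- The coordinate frame at `x` of the preferred chart around `x₀`, as a linear map. -/
def chartFrame (x₀ x : M) : EuclideanSpace ℝ (Fin m) →L[ℝ] TangentSpace (𝓡 m) x :=
  (trivializationAt (EuclideanSpace ℝ (Fin m)) (TangentSpace (𝓡 m)) x₀).symmL ℝ x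

/-- This passes from the derivative of the inverse chart to the trivialization of the tangent
bundle, where smoothness and invertibility of the frame are available. -/
theorem chartSymmDeriv_eq {x₀ : M} {y : EuclideanSpace ℝ (Fin m)}
    (hy : y ∈ (extChartAt (𝓡 m) x₀).target) :
    chartSymmDeriv x₀ y = chartFrame m x₀ ((extChartAt (𝓡 m) x₀).symm y) := by
  have hx : (extChartAt (𝓡 m) x₀).symm y ∈ (chartAt (EuclideanSpace ℝ (Fin m)) x₀).source := by
    simpa using (extChartAt (𝓡 m) x₀).map_target hy
  have key : ∀ z, z = y →
      (mfderiv (𝓡 m) (𝓡 m) (extChartAt (𝓡 m) x₀).symm z :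
        EuclideanSpace ℝ (Fin m) →L[ℝ] EuclideanSpace ℝ (Fin m)) =
      mfderiv (𝓡 m) (𝓡 m) (extChartAt (𝓡 m) x₀).symm y := by
    rintro _ rfl; rfl
  have h := TangentBundle.symmL_trivializationAt (I := 𝓡 m) hx
  rw [modelWithCornersSelf_coe, range_id, mfderivWithin_univ] at h
  refine Eq.trans ?_ h.symm
  exact (key _ ((extChartAt (𝓡 m) x₀).right_inv hy)).symm

theorem mdifferentiableAt_extChartAt_symm {x₀ : M} {y : EuclideanSpace ℝ (Fin m)}
    (hy : y ∈ (extChartAt (𝓡 m) x₀).target) :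
    MDifferentiableAt (𝓡 m) (𝓡 m) (extChartAt (𝓡 m) x₀).symm y := by
  have := mdifferentiableWithinAt_extChartAt_symm (I := 𝓡 m) hy
  rwa [modelWithCornersSelf_coe, range_id, mdifferentiableWithinAt_univ] at this

theorem inChart_apply {α : TwoForm m M} {x₀ : M} {y : EuclideanSpace ℝ (Fin m)}
    (hy : y ∈ (extChartAt (𝓡 m) x₀).target) (a b : EuclideanSpace ℝ (Fin m)) :
    α.inChart x₀ y ![a, b] =
      α ((extChartAt (𝓡 m) x₀).symm y) ![chartFrame m x₀ ((extChartAt (𝓡 m) x₀).symm y) a,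
        chartFrame m x₀ ((extChartAt (𝓡 m) x₀).symm y) b] := by
  rw [TwoForm.inChart, chartSymmDeriv_eq hy, ContinuousAlternatingMap.compContinuousLinearMap_apply]
  congr 1
  ext i
  fin_cases i <;> rfl

/-- The coordinate frame at a point of the chart domain, as a linear equivalence. -/
def chartFrameEquiv {x₀ x : M} (hx : x ∈ (extChartAt (𝓡 m) x₀).source) :
    EuclideanSpace ℝ (Fin m) ≃L[ℝ] TangentSpace (𝓡 m) x :=
  ((trivializationAt (EuclideanSpace ℝ (Fin m)) (TangentSpace (𝓡 m)) x₀).continuousLinearEquivAt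
    ℝ x (by simpa using hx)).symm

theorem chartFrameEquiv_apply {x₀ x : M} (hx : x ∈ (extChartAt (𝓡 m) x₀).source)
    (v : EuclideanSpace ℝ (Fin m)) : chartFrameEquiv hx v = chartFrame m x₀ x v := by
  have hb : x ∈ (trivializationAt (EuclideanSpace ℝ (Fin m)) (TangentSpace (𝓡 m)) x₀).baseSet := by
    simpa using hx
  rw [chartFrame, ← Trivialization.symm_continuousLinearEquivAt_eq _ hb]
  rfl

/-- The change of coordinates between two preferred charts. -/
theorem chartFrame_comp {x₀ x₁ x : M} (h₀ : x ∈ (extChartAt (𝓡 m) x₀).source)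
    (h₁ : x ∈ (extChartAt (𝓡 m) x₁).source) (v : EuclideanSpace ℝ (Fin m)) :
    chartFrame m x₀ x v = chartFrame m x₁ x
      (fderiv ℝ (extChartAt (𝓡 m) x₁ ∘ (extChartAt (𝓡 m) x₀).symm) (extChartAt (𝓡 m) x₀ x) v) := by
  have e0 : x ∈ (trivializationAt (EuclideanSpace ℝ (Fin m)) (TangentSpace (𝓡 m)) x₀).baseSet := by
    simpa using h₀
  have e1 : x ∈ (trivializationAt (EuclideanSpace ℝ (Fin m)) (TangentSpace (𝓡 m)) x₁).baseSet := by
    simpa using h₁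
  have c0 : x ∈ (chartAt (EuclideanSpace ℝ (Fin m)) x₀).source := by simpa using h₀
  have c1 : x ∈ (chartAt (EuclideanSpace ℝ (Fin m)) x₁).source := by simpa using h₁
  have hs := TangentBundle.symmL_trivializationAt_eq_core (I := 𝓡 m) c0
  have hs1 := TangentBundle.symmL_trivializationAt_eq_core (I := 𝓡 m) c1
  have hd := tangentBundleCore_coordChange (I := 𝓡 m) (M := M) (achart _ x₀) (achart _ x₁) x
  rw [modelWithCornersSelf_coe, range_id, fderivWithin_univ] at hd
  -- Cocycle identity: both frames at `x` are expressed through the chart at `x` itself.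
  have hc := (tangentBundleCore (𝓡 m) M).coordChange_comp (achart _ x₀) (achart _ x₁) (achart _ x) x
    (by simpa [tangentBundleCore] using ⟨⟨c0, c1⟩, mem_chart_source _ x⟩) v
  have : (fderiv ℝ (extChartAt (𝓡 m) x₁ ∘ (extChartAt (𝓡 m) x₀).symm) (extChartAt (𝓡 m) x₀ x)) =
    (tangentBundleCore (𝓡 m) M).coordChange (achart _ x₀) (achart _ x₁) x := hd.symm
  rw [this, chartFrame, chartFrame, hs, hs1]
  exact hc.symm

theorem contMDiffOn_chartFrame (x₀ : M) (v : EuclideanSpace ℝ (Fin m)) :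
    ContMDiffOn (𝓡 m) ((𝓡 m).prod 𝓘(ℝ, EuclideanSpace ℝ (Fin m))) ∞
      (fun x => (⟨x, chartFrame m x₀ x v⟩ : TangentBundle (𝓡 m) M))
      (extChartAt (𝓡 m) x₀).source := by
  have h := (trivializationAt (EuclideanSpace ℝ (Fin m)) (TangentSpace (𝓡 m))
    x₀).contMDiffOn_section_baseSet_iff (IB := 𝓡 m) (n := ∞) (s := fun x => chartFrame m x₀ x v)
  have hb : (trivializationAt (EuclideanSpace ℝ (Fin m)) (TangentSpace (𝓡 m)) x₀).baseSet
    = (extChartAt (𝓡 m) x₀).source := by simp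
  rw [hb] at h
  refine h.2 ((contMDiffOn_const (c := v)).congr ?_)
  intro x hx
  rw [← hb] at hx
  exact (trivializationAt (EuclideanSpace ℝ (Fin m)) (TangentSpace (𝓡 m))
    x₀).continuousLinearMapAt_symmL (R := ℝ) hx v |> fun h => by
      rw [Trivialization.continuousLinearMapAt_apply,
        Trivialization.coe_linearMapAt_of_mem _ hx] at h
      exact h

variable [RiemannianBundle (fun x : M => TangentSpace (𝓡 m) x)]

variable (m) in
/-- The volume density of the preferred chart around `x₀`, as a function on the manifold. -/
def density (x₀ x : M) : ℝ :=
  √(Matrix.gram ℝ (fun i : Fin m => chartFrame m x₀ x (EuclideanSpace.single i 1))).det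

theorem volumeDensity_eq {x₀ : M} {y : EuclideanSpace ℝ (Fin m)}
    (hy : y ∈ (extChartAt (𝓡 m) x₀).target) :
    volumeDensity x₀ y = density m x₀ ((extChartAt (𝓡 m) x₀).symm y) := by
  rw [volumeDensity, density, chartSymmDeriv_eq hy]

theorem det_gram_chartFrame_pos {x₀ x : M} (hx : x ∈ (extChartAt (𝓡 m) x₀).source) :
    0 < (Matrix.gram ℝ (fun i : Fin m => chartFrame m x₀ x (EuclideanSpace.single i 1))).det := by
  apply Matrix.PosDef.det_pos
  apply Matrix.posDef_gram_of_linearIndependent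
  have h1 := (EuclideanSpace.basisFun (Fin m) ℝ).toBasis.linearIndependent
  have h2 := h1.map' (chartFrameEquiv hx).toLinearEquiv.toLinearMap (LinearEquiv.ker _)
  have h3 : (fun i : Fin m => chartFrame m x₀ x (EuclideanSpace.single i 1)) =
      (chartFrameEquiv hx).toLinearEquiv.toLinearMap ∘
        (EuclideanSpace.basisFun (Fin m) ℝ).toBasis := by
    ext i
    simp [← chartFrameEquiv_apply hx]
  rw [h3]
  exact h2

theorem density_pos {x₀ x : M} (hx : x ∈ (extChartAt (𝓡 m) x₀).source) : 0 < density m x₀ x :=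
  Real.sqrt_pos.2 (det_gram_chartFrame_pos hx)

/-- The Gram matrices are related by `PᵀGP`, with `P` the Jacobian matrix of the transition map, so
the root of the determinant picks up `|det P|`. -/
theorem density_comp {x₀ x₁ x : M} (h₀ : x ∈ (extChartAt (𝓡 m) x₀).source)
    (h₁ : x ∈ (extChartAt (𝓡 m) x₁).source) :
    density m x₀ x =
      |(fderiv ℝ (extChartAt (𝓡 m) x₁ ∘ (extChartAt (𝓡 m) x₀).symm)
        (extChartAt (𝓡 m) x₀ x)).det| * density m x₁ x := by
  set A := fderiv ℝ (extChartAt (𝓡 m) x₁ ∘ (extChartAt (𝓡 m) x₀).symm) (extChartAt (𝓡 m) x₀ x)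
    with hA
  set b := (EuclideanSpace.basisFun (Fin m) ℝ).toBasis with hb
  set P := LinearMap.toMatrix b b A.toLinearMap with hP
  have hdet : A.det = P.det := by rw [hP, LinearMap.det_toMatrix]
  have e : ∀ i, chartFrame m x₀ x (EuclideanSpace.single i 1) =
      ∑ j, P j i • chartFrame m x₁ x (EuclideanSpace.single j 1) := by
    intro i
    rw [chartFrame_comp h₀ h₁, ← hA]
    have : A (EuclideanSpace.single i 1) = ∑ j, P j i • (EuclideanSpace.single j (1 : ℝ)) := by
      have := b.sum_repr (A (b i))
      simp only [hP, LinearMap.toMatrix_apply]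
      simpa [hb] using this.symm
    rw [this, map_sum]
    simp
  have hg : Matrix.gram ℝ (fun i : Fin m => chartFrame m x₀ x (EuclideanSpace.single i 1)) =
      P.transpose * Matrix.gram ℝ
        (fun i : Fin m => chartFrame m x₁ x (EuclideanSpace.single i 1)) * P := by
    ext i k
    rw [Matrix.gram_apply, e i, e k, sum_inner, Matrix.mul_apply]
    simp_rw [inner_sum, Matrix.mul_apply, Finset.sum_mul]
    rw [Finset.sum_comm]
    simp [inner_smul_left, inner_smul_right]
    refine Finset.sum_congr rfl fun a _ => Finset.sum_congr rfl fun c _ => ?_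
    ring
  rw [density, density, hg, Matrix.det_mul, Matrix.det_mul, Matrix.det_transpose, hdet,
    ← Real.sqrt_sq_eq_abs, ← Real.sqrt_mul (sq_nonneg _)]
  congr 1
  ring

variable [IsContMDiffRiemannianBundle (𝓡 m) ∞ (EuclideanSpace ℝ (Fin m))
      (fun x : M => TangentSpace (𝓡 m) x)]

/-- The Gram determinant is a polynomial in inner products of smooth sections and is positive, so
the square root is smooth along it. -/
theorem contMDiffOn_density (x₀ : M) :
    ContMDiffOn (𝓡 m) 𝓘(ℝ, ℝ) ∞ (density m x₀) (extChartAt (𝓡 m) x₀).source := by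
  have h1 : ContMDiffOn (𝓡 m) 𝓘(ℝ, ℝ) ∞ (fun x => (Matrix.gram ℝ
      (fun i : Fin m => chartFrame m x₀ x (EuclideanSpace.single i 1))).det)
      (extChartAt (𝓡 m) x₀).source := by
    simp only [Matrix.det_apply', Matrix.gram_apply]
    refine contMDiffOn_finsetSum fun σ _ => ?_
    refine contMDiffOn_const.mul ?_
    refine contMDiffOn_finsetProd fun i _ => ?_
    exact ContMDiffOn.inner_bundle (IB := 𝓡 m) (F := EuclideanSpace ℝ (Fin m))
      (E := fun x : M => TangentSpace (𝓡 m) x) (b := fun x => x)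
      (contMDiffOn_chartFrame x₀ _) (contMDiffOn_chartFrame x₀ _)
  intro x hx
  exact (Real.contDiffAt_sqrt (det_gram_chartFrame_pos hx).ne').contMDiffAt.comp_contMDiffWithinAt x
    (h1 x hx)

theorem contDiffOn_density_symm (x₀ : M) :
    ContDiffOn ℝ ∞ (fun y => density m x₀ ((extChartAt (𝓡 m) x₀).symm y))
      (extChartAt (𝓡 m) x₀).target := by
  rw [← contMDiffOn_iff_contDiffOn]
  exact (contMDiffOn_density x₀).comp (contMDiffOn_extChartAt_symm x₀)
    fun y hy => (extChartAt (𝓡 m) x₀).map_target hy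

end Charts

/-! ### The glued Riemannian volume and its integrals in charts. -/

section Volume

variable {m : ℕ} {M : Type*} [TopologicalSpace M] [ChartedSpace (EuclideanSpace ℝ (Fin m)) M]
  [MeasurableSpace M] [BorelSpace M]

theorem measurableSet_chart_preimage (x₀ : M) {S : Set M} (hS : MeasurableSet S) :
    MeasurableSet ((extChartAt (𝓡 m) x₀).target ∩ (extChartAt (𝓡 m) x₀).symm ⁻¹' S) := by
  have hT := (isOpen_extChartAt_target (I := 𝓡 m) x₀).measurableSet
  have h := (continuousOn_extChartAt_symm (I := 𝓡 m) x₀).domRestrict.measurable hS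
  have := (MeasurableEmbedding.subtype_coe hT).measurableSet_image.2 h
  convert this using 1
  ext y
  simp [and_comm]

theorem measurableSet_extChartAt_source (x₀ : M) :
    MeasurableSet (extChartAt (𝓡 m) x₀).source :=
  (isOpen_extChartAt_source (I := 𝓡 m) x₀).measurableSet

theorem aemeasurable_extChartAt_symm (x₀ : M) (f : EuclideanSpace ℝ (Fin m) → ℝ≥0∞) :
    AEMeasurable (extChartAt (𝓡 m) x₀).symm
      ((((volume : Measure (EuclideanSpace ℝ (Fin m))).restrict
        (extChartAt (𝓡 m) x₀).target)).withDensity f) :=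
  ((continuousOn_extChartAt_symm (I := 𝓡 m) x₀).aemeasurable
    (isOpen_extChartAt_target (I := 𝓡 m) x₀).measurableSet).mono_ac
      (withDensity_absolutelyContinuous _ _)

variable [RiemannianBundle (fun x : M => TangentSpace (𝓡 m) x)]

/-- The inverse chart is controlled only on the chart target. The measure being pushed forward
ignores the complement of the target, which allows the preimage to be cut down to it. -/
theorem chartVolume_apply (x₀ : M) {S : Set M} (hS : MeasurableSet S) :
    chartVolume (m := m) x₀ S =
      ∫⁻ y in (extChartAt (𝓡 m) x₀).target ∩ (extChartAt (𝓡 m) x₀).symm ⁻¹' S,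
        ENNReal.ofReal (volumeDensity x₀ y) := by
  have hT := (isOpen_extChartAt_target (I := 𝓡 m) x₀).measurableSet
  rw [chartVolume, Measure.map_apply_of_aemeasurable (aemeasurable_extChartAt_symm x₀ _) hS]
  set ν := (((volume : Measure (EuclideanSpace ℝ (Fin m))).restrict
        (extChartAt (𝓡 m) x₀).target)).withDensity
          (fun y => ENNReal.ofReal (volumeDensity x₀ y)) with hν
  have h0 : ν (extChartAt (𝓡 m) x₀).targetᶜ = 0 :=
    withDensity_absolutelyContinuous _ _ (by rw [Measure.restrict_apply hT.compl]; simp)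
  have h1 : ν ((extChartAt (𝓡 m) x₀).symm ⁻¹' S) =
      ν ((extChartAt (𝓡 m) x₀).target ∩ (extChartAt (𝓡 m) x₀).symm ⁻¹' S) := by
    rw [inter_comm]
    exact (measure_inter_conull h0).symm
  rw [h1, hν, withDensity_apply _ (measurableSet_chart_preimage x₀ hS),
    Measure.restrict_restrict (measurableSet_chart_preimage x₀ hS)]
  congr 2
  ext y; simp; tauto

theorem chartVolume_inter_source (x₀ : M) {S : Set M} (hS : MeasurableSet S) :
    chartVolume (m := m) x₀ S = chartVolume (m := m) x₀ (S ∩ (extChartAt (𝓡 m) x₀).source) := by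
  rw [chartVolume_apply x₀ hS, chartVolume_apply x₀ (hS.inter (measurableSet_extChartAt_source x₀))]
  congr 2
  ext y
  simp only [mem_inter_iff, mem_preimage]
  exact ⟨fun h => ⟨h.1, h.2, (extChartAt (𝓡 m) x₀).map_target h.1⟩, fun h => ⟨h.1, h.2.1⟩⟩

variable [IsManifold (𝓡 m) ∞ M]

/-- The chart volumes agree on overlaps of charts, by the change of variables formula. -/
theorem chartVolume_eq_chartVolume {x₀ x₁ : M} {S : Set M} (hS : MeasurableSet S)
    (h₀ : S ⊆ (extChartAt (𝓡 m) x₀).source) (h₁ : S ⊆ (extChartAt (𝓡 m) x₁).source) :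
    chartVolume (m := m) x₀ S = chartVolume (m := m) x₁ S := by
  rw [chartVolume_apply x₀ hS, chartVolume_apply x₁ hS]
  set e₀ := extChartAt (𝓡 m) x₀ with he₀
  set e₁ := extChartAt (𝓡 m) x₁ with he₁
  set τ := e₁ ∘ e₀.symm with hτ
  have him : e₁.target ∩ e₁.symm ⁻¹' S = τ '' (e₀.target ∩ e₀.symm ⁻¹' S) := by
    ext z
    constructor
    · rintro ⟨hz, hzS⟩
      refine ⟨e₀ (e₁.symm z), ⟨e₀.map_source (h₀ hzS), ?_⟩, ?_⟩
      · rw [mem_preimage, e₀.left_inv (h₀ hzS)]; exact hzS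
      · rw [hτ, Function.comp_apply, e₀.left_inv (h₀ hzS), e₁.right_inv hz]
    · rintro ⟨y, ⟨hy, hyS⟩, rfl⟩
      refine ⟨e₁.map_source (h₁ hyS), ?_⟩
      rw [mem_preimage, hτ, Function.comp_apply, e₁.left_inv (h₁ hyS)]
      exact hyS
  have hinj : InjOn τ (e₀.target ∩ e₀.symm ⁻¹' S) := by
    intro y hy y' hy' h
    exact e₀.symm.injOn hy.1 hy'.1 (e₁.injOn (h₁ hy.2) (h₁ hy'.2) h)
  have hder : ∀ y ∈ e₀.target ∩ e₀.symm ⁻¹' S,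
      HasFDerivWithinAt τ (fderiv ℝ τ y) (e₀.target ∩ e₀.symm ⁻¹' S) y := by
    intro y hy
    have hsrc : y ∈ (e₀.symm.trans e₁).source := by
      rw [PartialEquiv.trans_source, PartialEquiv.symm_source]
      exact ⟨hy.1, h₁ hy.2⟩
    have := contDiffWithinAt_ext_coord_change (I := 𝓡 m) (n := ∞) x₁ x₀ hsrc
    rw [modelWithCornersSelf_coe, range_id, contDiffWithinAt_univ] at this
    exact (this.differentiableAt (by simp)).hasFDerivAt.hasFDerivWithinAt
  rw [him, lintegral_image_eq_lintegral_abs_det_fderiv_mul _ (measurableSet_chart_preimage x₀ hS)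
    hder hinj]
  refine setLIntegral_congr_fun (measurableSet_chart_preimage x₀ hS) fun y hy => ?_
  have hx0 : e₀.symm y ∈ e₀.source := e₀.map_target hy.1
  have hx1 : e₀.symm y ∈ e₁.source := h₁ hy.2
  have ht : τ y ∈ e₁.target := e₁.map_source hx1
  have hs : e₁.symm (τ y) = e₀.symm y := e₁.left_inv hx1
  rw [volumeDensity_eq hy.1, volumeDensity_eq ht, hs, density_comp hx0 hx1, ← he₀, ← he₁,
    e₀.right_inv hy.1, ENNReal.ofReal_mul (abs_nonneg _)]

variable [SecondCountableTopology M]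

/-- The Riemannian volume agrees with the chart volume on the domain of a chart. -/
theorem riemannianVolume_apply {x₀ : M} {S : Set M} (hS : MeasurableSet S)
    (h₀ : S ⊆ (extChartAt (𝓡 m) x₀).source) :
    riemannianVolume m M S = chartVolume (m := m) x₀ S := by
  have : Nonempty M := ⟨x₀⟩
  obtain ⟨s, hs, hcov⟩ := TopologicalSpace.countable_cover_nhds
    (fun x : M => extChartAt_source_mem_nhds (I := 𝓡 m) x)
  have hsne : s.Nonempty := by
    by_contra h
    rw [not_nonempty_iff_eq_empty] at h
    subst h
    simp at hcov
    exact absurd (mem_univ x₀) (hcov ▸ notMem_empty x₀)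
  obtain ⟨c, rfl⟩ := hs.exists_eq_range hsne
  set src : ℕ → Set M := fun i => (extChartAt (𝓡 m) (c i)).source with hsrc
  have hcov' : ⋃ i, src i = univ := by
    rw [← hcov, biUnion_range]
  have hDm : ∀ i, MeasurableSet (disjointed src i) := fun i =>
    MeasurableSet.disjointed (fun j => measurableSet_extChartAt_source (c j)) i
  have hDu : ⋃ i, disjointed src i = univ := by rw [iUnion_disjointed, hcov']
  have split : ∀ (ν : Measure M) (T : Set M), MeasurableSet T →
      ν T = ∑' i, ν (T ∩ disjointed src i) := by
    intro ν T hT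
    rw [← measure_iUnion (fun i j hij => (disjoint_disjointed src hij).mono
      inter_subset_right inter_subset_right) (fun i => hT.inter (hDm i)), ← inter_iUnion, hDu,
      inter_univ]
  -- The candidate for the glued measure: a countable disjoint cover by pieces of chart domains,
  -- with the volume of one chart used on each piece.
  set μ : Measure M := Measure.sum fun i =>
    (chartVolume (m := m) (c i)).restrict (disjointed src i) with hμ
  have hμa : ∀ T, MeasurableSet T →
      μ T = ∑' i, chartVolume (m := m) (c i) (T ∩ disjointed src i) := by
    intro T hT
    rw [hμ, Measure.sum_apply _ hT]
    simp only [Measure.restrict_apply hT]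
  have agree : ∀ (x : M) (T : Set M), MeasurableSet T → T ⊆ (extChartAt (𝓡 m) x).source →
      chartVolume (m := m) x T = μ T := by
    intro x T hT hTx
    rw [split _ T hT, hμa T hT]
    refine tsum_congr fun i => chartVolume_eq_chartVolume (hT.inter (hDm i))
      (inter_subset_left.trans hTx) (inter_subset_right.trans (disjointed_subset src i))
  -- The supremum dominates each chart volume. Conversely `μ` bounds all of them from above, and it
  -- equals `chartVolume x₀` on `S`.
  refine le_antisymm ?_ (Measure.le_iff'.1 (le_iSup (fun x => chartVolume (m := m) x) x₀) S)
  rw [agree x₀ S hS h₀]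
  refine Measure.le_iff'.1 (iSup_le fun x => Measure.le_iff.2 fun T hT => ?_) S
  rw [chartVolume_inter_source x hT,
    agree x _ (hT.inter (measurableSet_extChartAt_source x)) inter_subset_right]
  exact measure_mono inter_subset_left

variable [IsContMDiffRiemannianBundle (𝓡 m) ∞ (EuclideanSpace ℝ (Fin m))
      (fun x : M => TangentSpace (𝓡 m) x)]

theorem riemannianVolume_lt_top_of_isCompact {x₀ : M} [T2Space M] {K : Set M} (hK : IsCompact K)
    (hKs : K ⊆ (extChartAt (𝓡 m) x₀).source) : riemannianVolume m M K < (⊤ : ℝ≥0∞) := by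
  set e := extChartAt (𝓡 m) x₀ with he
  have him : e.target ∩ e.symm ⁻¹' K = e '' K := by
    rw [e.image_eq_target_inter_inv_preimage hKs]
  have hKc : IsCompact (e '' K) := hK.image_of_continuousOn
    ((continuousOn_extChartAt (I := 𝓡 m) x₀).mono hKs)
  have hKt : e '' K ⊆ e.target := by rw [← him]; exact inter_subset_left
  rw [riemannianVolume_apply hK.measurableSet hKs, chartVolume_apply x₀ hK.measurableSet, him]
  have hint : IntegrableOn (fun y => volumeDensity x₀ y) (e '' K) := by
    refine ContinuousOn.integrableOn_compact hKc ?_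
    refine ((contDiffOn_density_symm x₀).continuousOn.mono hKt).congr fun y hy => ?_
    exact volumeDensity_eq (hKt hy)
  exact hint.lintegral_lt_top

theorem isFiniteMeasure_riemannianVolume [T2Space M] [CompactSpace M] :
    IsFiniteMeasure (riemannianVolume m M) := by
  have : LocallyCompactSpace M := inferInstance
  have hl : IsLocallyFiniteMeasure (riemannianVolume m M) := ⟨fun x => by
    obtain ⟨K, hK, hKs, hKc⟩ := local_compact_nhds (extChartAt_source_mem_nhds (I := 𝓡 m) x)
    exact ⟨K, hK, riemannianVolume_lt_top_of_isCompact hKc hKs⟩⟩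
  exact inferInstance

/-- Integrals over a compact subset of a chart domain, in coordinates. -/
theorem setIntegral_riemannianVolume {x₀ : M} [T2Space M] {K : Set M} (hK : IsCompact K)
    (hKs : K ⊆ (extChartAt (𝓡 m) x₀).source) {g : M → ℝ} (hg : ContinuousOn g K) :
    ∫ x in K, g x ∂(riemannianVolume m M) =
      ∫ y in extChartAt (𝓡 m) x₀ '' K, density m x₀ ((extChartAt (𝓡 m) x₀).symm y) *
        g ((extChartAt (𝓡 m) x₀).symm y) := by
  set e := extChartAt (𝓡 m) x₀ with he
  have him : e.target ∩ e.symm ⁻¹' K = e '' K := by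
    rw [e.image_eq_target_inter_inv_preimage hKs]
  have hKc : IsCompact (e '' K) := hK.image_of_continuousOn
    ((continuousOn_extChartAt (I := 𝓡 m) x₀).mono hKs)
  have hKt : e '' K ⊆ e.target := by rw [← him]; exact inter_subset_left
  have hcont : ContinuousOn (fun y => density m x₀ (e.symm y)) (e '' K) :=
    (contDiffOn_density_symm x₀).continuousOn.mono hKt
  set ν : Measure (EuclideanSpace ℝ (Fin m)) := (volume.restrict (e '' K)).withDensity
    (fun y => ENNReal.ofReal (density m x₀ (e.symm y))) with hν
  have hae : AEMeasurable e.symm ν :=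
    (((continuousOn_extChartAt_symm (I := 𝓡 m) x₀).mono hKt).aemeasurable
      hKc.measurableSet).mono_ac (withDensity_absolutelyContinuous _ _)
  have hmap : (riemannianVolume m M).restrict K = ν.map e.symm := by
    ext S hS
    rw [Measure.restrict_apply hS, riemannianVolume_apply (x₀ := x₀) (hS.inter hK.measurableSet)
      (inter_subset_right.trans hKs), chartVolume_apply x₀ (hS.inter hK.measurableSet),
      Measure.map_apply_of_aemeasurable hae hS]
    have hm := measurableSet_chart_preimage (m := m) x₀ (hS.inter hK.measurableSet)
    have h0 : ν (e '' K)ᶜ = 0 := withDensity_absolutelyContinuous _ _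
      (by rw [Measure.restrict_apply hKc.measurableSet.compl]; simp)
    have h1 : ν (e.symm ⁻¹' S) = ν (e.target ∩ e.symm ⁻¹' (S ∩ K)) := by
      refine le_antisymm ?_ (measure_mono fun y hy => hy.2.1)
      rw [← measure_inter_conull h0]
      refine measure_mono ?_
      rw [← him]
      exact fun y hy => ⟨hy.2.1, hy.1, hy.2.2⟩
    rw [h1, hν, withDensity_apply _ hm, Measure.restrict_restrict hm, ← he]
    have h2 : e.target ∩ e.symm ⁻¹' (S ∩ K) ∩ e '' K = e.target ∩ e.symm ⁻¹' (S ∩ K) := by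
      rw [inter_eq_left, ← him]
      exact fun y hy => ⟨hy.1, hy.2.2⟩
    rw [h2]
    refine setLIntegral_congr_fun hm fun y hy => ?_
    rw [volumeDensity_eq hy.1]
  have hgm : AEStronglyMeasurable g (ν.map e.symm) := by
    rw [← hmap]; exact (hg.aemeasurable hK.measurableSet).aestronglyMeasurable
  rw [hmap, integral_map hae hgm, hν, integral_withDensity_eq_integral_toReal_smul₀]
  · refine integral_congr_ae (Eventually.of_forall fun y => ?_)
    simp only [smul_eq_mul]
    rw [ENNReal.toReal_ofReal (show 0 ≤ density m x₀ _ from Real.sqrt_nonneg _)]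
  · exact (hcont.aemeasurable hKc.measurableSet).ennreal_ofReal
  · exact Eventually.of_forall fun _ => ENNReal.ofReal_lt_top

end Volume

/-! ### Two-forms and the volume form on an oriented Euclidean plane. -/

section LinearAlgebra

variable {V : Type*} [NormedAddCommGroup V] [InnerProductSpace ℝ V]
  [Fact (Module.finrank ℝ V = 2)]

theorem eq_smul_volumeForm (o : Orientation ℝ V (Fin 2)) (α : V [⋀^Fin 2]→ₗ[ℝ] ℝ) :
    α = α (o.finOrthonormalBasis two_pos Fact.out) • o.volumeForm := by
  set b := o.finOrthonormalBasis two_pos Fact.out with hb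
  rw [o.volumeForm_robust b (o.finOrthonormalBasis_orientation two_pos Fact.out)]
  have := α.eq_smul_basis_det b.toBasis
  simpa using this

/-- The sum has a single term, and the volume form is `±1` on any orthonormal basis, so the square
does not see the choice. The index `d` is kept variable because the standard orthonormal basis is
indexed by `Fin` of the rank, not literally by `Fin 2`. -/
theorem sum_orthonormalBasis_sq (o : Orientation ℝ V (Fin 2)) (α : V [⋀^Fin 2]→ₗ[ℝ] ℝ)
    {d : ℕ} (hd : d = 2) (b : OrthonormalBasis (Fin d) ℝ V) :
    ∑ i, ∑ j ∈ Finset.Ioi i, (α ![b i, b j]) ^ 2 =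
      α (o.finOrthonormalBasis two_pos Fact.out) ^ 2 := by
  subst hd
  have h1 := o.abs_volumeForm_apply_of_orthonormal b
  have h2 : (![b 0, b 1] : Fin 2 → V) = b := by ext i; fin_cases i <;> rfl
  have h3 : α b = α (o.finOrthonormalBasis two_pos Fact.out) * o.volumeForm b := by
    conv_lhs => rw [eq_smul_volumeForm o α]
    rfl
  have e0 : Finset.Ioi (0 : Fin 2) = {1} := by decide
  have e1 : Finset.Ioi (1 : Fin 2) = ∅ := by decide
  rw [Fin.sum_univ_two, e0, e1, Finset.sum_singleton, Finset.sum_empty, add_zero, h2, h3, mul_pow,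
    ← sq_abs (o.volumeForm b), h1]
  ring

/-- Lagrange's identity `⟪a, b⟫² + vol(a, b)² = ‖a‖² ‖b‖²`. -/
theorem volumeForm_sq (o : Orientation ℝ V (Fin 2)) (v : Fin 2 → V) :
    o.volumeForm v ^ 2 = (Matrix.gram ℝ v).det := by
  have h := o.inner_sq_add_areaForm_sq (v 0) (v 1)
  have h2 : (![v 0, v 1] : Fin 2 → V) = v := by ext i; fin_cases i <;> rfl
  rw [o.areaForm_to_volumeForm, h2] at h
  rw [Matrix.det_fin_two]
  simp only [Matrix.gram_apply, real_inner_self_eq_norm_sq, real_inner_comm (v 0) (v 1)]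
  linarith

theorem volumeForm_pos_iff (o : Orientation ℝ V (Fin 2)) (b : Module.Basis (Fin 2) ℝ V) :
    0 < o.volumeForm b ↔ o = b.orientation := by
  have h := o.finOrthonormalBasis_orientation two_pos Fact.out
  rw [o.volumeForm_robust _ h, ← Module.Basis.orientation_eq_iff_det_pos, h]

/-- The volume form on a basis, up to the sign given by its orientation. -/
theorem volumeForm_basis (o : Orientation ℝ V (Fin 2)) (b : Module.Basis (Fin 2) ℝ V) :
    o.volumeForm b = (open Classical in if o = b.orientation then 1 else -1) *
      √(Matrix.gram ℝ b).det := by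
  rw [← volumeForm_sq o, Real.sqrt_sq_eq_abs]
  split_ifs with h
  · rw [abs_of_pos ((volumeForm_pos_iff o b).2 h), one_mul]
  · rw [abs_of_nonpos (not_lt.1 fun h' => h ((volumeForm_pos_iff o b).1 h'))]
    ring

end LinearAlgebra

/-! ### Oriented chart domains and the Hodge star in coordinates. -/

section Surface

variable {M : Type*} [TopologicalSpace M] [ChartedSpace (EuclideanSpace ℝ (Fin 2)) M]
  [IsManifold (𝓡 2) ∞ M] [RiemannianBundle (fun x : M => TangentSpace (𝓡 2) x)]

theorem toAlternatingMap_eq_hodgeStarTwo_smul (o : ManifoldOrientation 2 M) (α : TwoForm 2 M)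
    (x : M) : (α x).toAlternatingMap = hodgeStarTwo o α x • (o.at' x).volumeForm :=
  eq_smul_volumeForm (o.at' x) (α x).toAlternatingMap

theorem normSq_eq_hodgeStarTwo_sq (o : ManifoldOrientation 2 M) (α : TwoForm 2 M) (x : M) :
    normSq α x = hodgeStarTwo o α x ^ 2 :=
  sum_orthonormalBasis_sq (o.at' x) (α x).toAlternatingMap Fact.out
    (stdOrthonormalBasis ℝ (TangentSpace (𝓡 2) x))

/-- The first standard basis vector. -/
abbrev e₀ : EuclideanSpace ℝ (Fin 2) := EuclideanSpace.single 0 1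

/-- The second standard basis vector. -/
abbrev e₁ : EuclideanSpace ℝ (Fin 2) := EuclideanSpace.single 1 1

/-- An oriented chart domain: on `O` the volume form is `ε √ det (g_ij) dx ∧ dy`, with a constant
sign `ε`. -/
structure IsOrientedPatch (o : ManifoldOrientation 2 M) (x₀ : M) (O : Set M) (ε : ℝ) : Prop where
  isOpen : IsOpen O
  subset : O ⊆ (extChartAt (𝓡 2) x₀).source
  sq_eq : ε * ε = 1
  volumeForm_eq : ∀ x ∈ O, (o.at' x).volumeForm ![chartFrame 2 x₀ x e₀, chartFrame 2 x₀ x e₁] =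
    ε * density 2 x₀ x

/-- The size of the volume form on the frame is the root of the Gram determinant. Its sign compares
the frame with the orientation, which is constant near `x₀` in coordinates. -/
theorem exists_isOrientedPatch (o : ManifoldOrientation 2 M) (x₀ : M) :
    ∃ O ε, x₀ ∈ O ∧ IsOrientedPatch o x₀ O ε := by
  classical
  obtain ⟨O₁, hO₁, hO₁o, hx₁⟩ := eventually_nhds_iff.1 (o.locally_const x₀)
  set C := Orientation.map (Fin 2)
    ((trivializationAt (EuclideanSpace ℝ (Fin 2)) (TangentSpace (𝓡 2)) x₀).linearEquivAt
      ℝ x₀ (FiberBundle.mem_baseSet_trivializationAt' x₀)) (o.at' x₀) with hC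
  set b₀ := (EuclideanSpace.basisFun (Fin 2) ℝ).toBasis with hb₀
  refine ⟨O₁ ∩ (extChartAt (𝓡 2) x₀).source, if C = b₀.orientation then 1 else -1,
    ⟨hx₁, mem_extChartAt_source x₀⟩, hO₁o.inter (isOpen_extChartAt_source x₀), inter_subset_right,
    by split_ifs <;> norm_num, ?_⟩
  rintro x ⟨hx, hxs⟩
  have hxb : x ∈ (trivializationAt (EuclideanSpace ℝ (Fin 2)) (TangentSpace (𝓡 2)) x₀).baseSet := by
    simpa using hxs
  have h := hO₁ x hx hxb
  set L := (trivializationAt (EuclideanSpace ℝ (Fin 2)) (TangentSpace (𝓡 2)) x₀).linearEquivAt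
    ℝ x hxb with hL
  set b := b₀.map L.symm with hb
  have hbv : ∀ i, b i = chartFrame 2 x₀ x (EuclideanSpace.single i 1) := by
    intro i
    rw [hb, Module.Basis.map_apply, ← chartFrameEquiv_apply hxs, hb₀]
    simp
    rfl
  have key := volumeForm_basis (o.at' x) b
  have hv : (![chartFrame 2 x₀ x e₀, chartFrame 2 x₀ x e₁] : Fin 2 → TangentSpace (𝓡 2) x) = b := by
    ext i; fin_cases i
    · exact (hbv 0).symm
    · exact (hbv 1).symm
  have hgram : √(Matrix.gram ℝ b).det = density 2 x₀ x := by
    rw [density]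
    congr 3
    funext i
    exact hbv i
  have hiff : o.at' x = b.orientation ↔ C = b₀.orientation := by
    rw [← h, hb, Module.Basis.orientation_map]
    constructor
    · intro h'
      rw [h', ← Module.Basis.orientation_map, ← Module.Basis.orientation_map]
      congr 1
      ext i
      simp
    · intro h'
      rw [← h', ← Orientation.map_symm]
      exact ((Orientation.map (Fin 2) L).symm_apply_apply _).symm
  rw [hv, key, hgram]
  congr 1
  simp only [hiff]

theorem IsOrientedPatch.hodgeStarTwo_eq {o : ManifoldOrientation 2 M} {x₀ : M} {O : Set M} {ε : ℝ}
    (h : IsOrientedPatch o x₀ O ε) (α : TwoForm 2 M) {x : M} (hx : x ∈ O) :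
    hodgeStarTwo o α x =
      ε * (α x ![chartFrame 2 x₀ x e₀, chartFrame 2 x₀ x e₁] / density 2 x₀ x) := by
  have h1 : α x ![chartFrame 2 x₀ x e₀, chartFrame 2 x₀ x e₁] =
      hodgeStarTwo o α x * (ε * density 2 x₀ x) := by
    rw [← h.volumeForm_eq x hx]
    exact congrArg (fun β => β ![chartFrame 2 x₀ x e₀, chartFrame 2 x₀ x e₁])
      (toAlternatingMap_eq_hodgeStarTwo_smul o α x)
  have hd := (density_pos (h.subset hx)).ne'
  rw [h1, ← mul_assoc, mul_div_assoc, div_self hd, mul_one, mul_comm, mul_assoc, h.sq_eq, mul_one]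

end Surface

/-! ### Pull-backs in coordinates. -/

section PullbackChart

variable {m n : ℕ} {M N : Type*}
  [TopologicalSpace M] [ChartedSpace (EuclideanSpace ℝ (Fin m)) M] [IsManifold (𝓡 m) ∞ M]
  [TopologicalSpace N] [ChartedSpace (EuclideanSpace ℝ (Fin n)) N] [IsManifold (𝓡 n) ∞ N]

theorem inChart_extChartAt_apply {α : TwoForm m M} {x₀ x : M}
    (hx : x ∈ (extChartAt (𝓡 m) x₀).source) (a b : EuclideanSpace ℝ (Fin m)) :
    α.inChart x₀ (extChartAt (𝓡 m) x₀ x) ![a, b] =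
      α x ![chartFrame m x₀ x a, chartFrame m x₀ x b] := by
  rw [inChart_apply ((extChartAt (𝓡 m) x₀).map_source hx)]
  have key : ∀ z, z = x → α z ![chartFrame m x₀ z a, chartFrame m x₀ z b] =
      α x ![chartFrame m x₀ x a, chartFrame m x₀ x b] := by rintro _ rfl; rfl
  exact key _ ((extChartAt (𝓡 m) x₀).left_inv hx)

/-- The coordinate expression of a map in the preferred charts around `x₀` and `p₀`. -/
def inCharts (x₀ : M) (p₀ : N) (ψ : M → N) : EuclideanSpace ℝ (Fin m) → EuclideanSpace ℝ (Fin n) :=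
  fun y => extChartAt (𝓡 n) p₀ (ψ ((extChartAt (𝓡 m) x₀).symm y))

/-- Chain rule for chart ∘ `ψ` ∘ inverse chart. The base point produced by the composition equals
`x` only propositionally, hence the auxiliary statements over all `z = x`. -/
theorem mfderiv_chartFrame {x₀ x : M} {p₀ : N} {ψ : M → N}
    (hψ : MDifferentiableAt (𝓡 m) (𝓡 n) ψ x) (hx : x ∈ (extChartAt (𝓡 m) x₀).source)
    (hp : ψ x ∈ (extChartAt (𝓡 n) p₀).source) (v : EuclideanSpace ℝ (Fin m)) :
    mfderiv (𝓡 m) (𝓡 n) ψ x (chartFrame m x₀ x v) =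
      chartFrame n p₀ (ψ x) (fderiv ℝ (inCharts x₀ p₀ ψ) (extChartAt (𝓡 m) x₀ x) v) := by
  have hxc : x ∈ (chartAt (EuclideanSpace ℝ (Fin m)) x₀).source := by simpa using hx
  have hpc : ψ x ∈ (chartAt (EuclideanSpace ℝ (Fin n)) p₀).source := by simpa using hp
  have hpb : ψ x ∈
      (trivializationAt (EuclideanSpace ℝ (Fin n)) (TangentSpace (𝓡 n)) p₀).baseSet := by
    simpa using hp
  have hinv := (extChartAt (𝓡 m) x₀).left_inv hx
  have h1 : HasMFDerivAt (𝓡 m) (𝓡 m) (extChartAt (𝓡 m) x₀).symm (extChartAt (𝓡 m) x₀ x)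
      (chartFrame m x₀ x : EuclideanSpace ℝ (Fin m) →L[ℝ] EuclideanSpace ℝ (Fin m)) := by
    have h := TangentBundle.symmL_trivializationAt (I := 𝓡 m) hxc
    rw [modelWithCornersSelf_coe, range_id, mfderivWithin_univ] at h
    rw [chartFrame, h]
    exact (mdifferentiableAt_extChartAt_symm ((extChartAt (𝓡 m) x₀).map_source hx)).hasMFDerivAt
  have h2 : ∀ z, z = x → HasMFDerivAt (𝓡 m) (𝓡 n) ψ z
      (mfderiv (𝓡 m) (𝓡 n) ψ x : EuclideanSpace ℝ (Fin m) →L[ℝ] EuclideanSpace ℝ (Fin n)) := by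
    rintro _ rfl; exact hψ.hasMFDerivAt
  have h3 : ∀ z, z = x → HasMFDerivAt (𝓡 n) 𝓘(ℝ, EuclideanSpace ℝ (Fin n)) (extChartAt (𝓡 n) p₀)
      (ψ z) ((trivializationAt (EuclideanSpace ℝ (Fin n)) (TangentSpace (𝓡 n))
        p₀).continuousLinearMapAt ℝ (ψ x) :
          EuclideanSpace ℝ (Fin n) →L[ℝ] EuclideanSpace ℝ (Fin n)) := by
    rintro _ rfl
    rw [TangentBundle.continuousLinearMapAt_trivializationAt (I := 𝓡 n) hpc]
    exact (mdifferentiableAt_extChartAt hpc).hasMFDerivAt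
  have h4 := ((h3 _ hinv).comp (f := ψ) _ (h2 _ hinv)).comp _ h1
  have comp : ∀ {f : EuclideanSpace ℝ (Fin m) → EuclideanSpace ℝ (Fin n)}
      {y : EuclideanSpace ℝ (Fin m)}
      {L : EuclideanSpace ℝ (Fin m) →L[ℝ] EuclideanSpace ℝ (Fin n)},
      HasMFDerivAt (𝓡 m) 𝓘(ℝ, EuclideanSpace ℝ (Fin n)) f y L →
        fderiv ℝ f y = L := fun {f y L} h => by
    have h' : HasFDerivAt f L y := hasMFDerivAt_iff_hasFDerivAt.1 h
    exact h'.fderiv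
  have h5 := comp (f := inCharts x₀ p₀ ψ) h4
  have h6 : fderiv ℝ (inCharts x₀ p₀ ψ) (extChartAt (𝓡 m) x₀ x) v =
      (trivializationAt (EuclideanSpace ℝ (Fin n)) (TangentSpace (𝓡 n)) p₀).continuousLinearMapAt ℝ
        (ψ x) (mfderiv (𝓡 m) (𝓡 n) ψ x (chartFrame m x₀ x v)) :=
    congrArg (fun L : EuclideanSpace ℝ (Fin m) →L[ℝ] EuclideanSpace ℝ (Fin n) => L v) h5
  rw [h6]
  exact ((trivializationAt (EuclideanSpace ℝ (Fin n)) (TangentSpace (𝓡 n))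
    p₀).symmL_continuousLinearMapAt (R := ℝ) hpb _).symm

/-- The expression of a 2-form in the preferred chart around `p₀`, as a field of bilinear forms. -/
def formInChart (Ω : TwoForm n N) (p₀ : N) (z : EuclideanSpace ℝ (Fin n)) :
    EuclideanSpace ℝ (Fin n) →L[ℝ] EuclideanSpace ℝ (Fin n) →L[ℝ] ℝ :=
  toBilin (EuclideanSpace ℝ (Fin n)) (Ω.inChart p₀ z)

/-- The pull-back of a 2-form in coordinates. -/
theorem pullback_chartFrame {x₀ x : M} {p₀ : N} {ψ : M → N} {Ω : TwoForm n N}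
    (hψ : MDifferentiableAt (𝓡 m) (𝓡 n) ψ x) (hx : x ∈ (extChartAt (𝓡 m) x₀).source)
    (hp : ψ x ∈ (extChartAt (𝓡 n) p₀).source) (a b : EuclideanSpace ℝ (Fin m)) :
    pullback (m := m) ψ Ω x ![chartFrame m x₀ x a, chartFrame m x₀ x b] =
      dens (formInChart Ω p₀) a b (inCharts x₀ p₀ ψ) (extChartAt (𝓡 m) x₀ x) := by
  have e : inCharts x₀ p₀ ψ (extChartAt (𝓡 m) x₀ x) = extChartAt (𝓡 n) p₀ (ψ x) := by
    rw [inCharts, (extChartAt (𝓡 m) x₀).left_inv hx]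
  rw [dens, formInChart, e, toBilin_apply, inChart_extChartAt_apply hp,
    ← mfderiv_chartFrame hψ hx hp,
    ← mfderiv_chartFrame hψ hx hp, pullback, ContinuousAlternatingMap.compContinuousLinearMap_apply]
  congr 1
  ext i
  fin_cases i <;> rfl

end PullbackChart

/-! ### Moving a map inside a chart of the target. -/

section Patch

variable {n : ℕ} {N : Type*} [TopologicalSpace N] [ChartedSpace (EuclideanSpace ℝ (Fin n)) N]

/-- The map `φ` translated by `w` in the preferred chart around `p₀`. -/
def patch {X : Type*} (p₀ : N) (φ : X → N) (w : X → EuclideanSpace ℝ (Fin n)) (x : X) : N :=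
  open Classical in
  if φ x ∈ (extChartAt (𝓡 n) p₀).source then
    (extChartAt (𝓡 n) p₀).symm (extChartAt (𝓡 n) p₀ (φ x) + w x)
  else φ x

variable {X : Type*} {p₀ : N} {φ : X → N} {w : X → EuclideanSpace ℝ (Fin n)} {x : X}

theorem patch_of_mem (hx : φ x ∈ (extChartAt (𝓡 n) p₀).source) :
    patch p₀ φ w x = (extChartAt (𝓡 n) p₀).symm (extChartAt (𝓡 n) p₀ (φ x) + w x) := if_pos hx

theorem patch_of_eq_zero (hw : w x = 0) : patch p₀ φ w x = φ x := by
  rw [patch]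
  split_ifs with h
  · rw [hw, add_zero, (extChartAt (𝓡 n) p₀).left_inv h]
  · rfl

theorem patch_zero : patch p₀ φ (0 : X → EuclideanSpace ℝ (Fin n)) = φ :=
  funext fun _ => patch_of_eq_zero rfl

theorem extChartAt_patch (hx : φ x ∈ (extChartAt (𝓡 n) p₀).source)
    (ht : extChartAt (𝓡 n) p₀ (φ x) + w x ∈ (extChartAt (𝓡 n) p₀).target) :
    extChartAt (𝓡 n) p₀ (patch p₀ φ w x) = extChartAt (𝓡 n) p₀ (φ x) + w x := by
  rw [patch_of_mem hx, (extChartAt (𝓡 n) p₀).right_inv ht]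

theorem patch_mem_source (hx : φ x ∈ (extChartAt (𝓡 n) p₀).source)
    (ht : extChartAt (𝓡 n) p₀ (φ x) + w x ∈ (extChartAt (𝓡 n) p₀).target) :
    patch p₀ φ w x ∈ (extChartAt (𝓡 n) p₀).source := by
  rw [patch_of_mem hx]
  exact (extChartAt (𝓡 n) p₀).map_target ht

theorem patch_eventuallyEq [TopologicalSpace X] (hx : x ∉ tsupport w) :
    patch p₀ φ w =ᶠ[𝓝 x] φ := by
  filter_upwards [notMem_tsupport_iff_eventuallyEq.1 hx] with z hz using patch_of_eq_zero hz

variable {E H : Type*} [NormedAddCommGroup E] [NormedSpace ℝ E] [TopologicalSpace H]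
  {I : ModelWithCorners ℝ E H} [TopologicalSpace X] [ChartedSpace H X] {k : ℕ∞ω}
  [IsManifold (𝓡 n) k N]

theorem contMDiffAt_patch (hφ : ContMDiffAt I (𝓡 n) k φ x)
    (hw : ContMDiffAt I 𝓘(ℝ, EuclideanSpace ℝ (Fin n)) k w x)
    (hx : φ x ∈ (extChartAt (𝓡 n) p₀).source)
    (ht : extChartAt (𝓡 n) p₀ (φ x) + w x ∈ (extChartAt (𝓡 n) p₀).target) :
    ContMDiffAt I (𝓡 n) k (patch p₀ φ w) x := by
  have h1 : ContMDiffAt I 𝓘(ℝ, EuclideanSpace ℝ (Fin n)) k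
      (fun z => extChartAt (𝓡 n) p₀ (φ z) + w z) x := by
    refine ContMDiffAt.add ?_ hw
    refine ContMDiffAt.comp x (g := extChartAt (𝓡 n) p₀) ?_ hφ
    exact contMDiffAt_extChartAt' (by simpa using hx)
  have h2 : ContMDiffAt 𝓘(ℝ, EuclideanSpace ℝ (Fin n)) (𝓡 n) k (extChartAt (𝓡 n) p₀).symm
      (extChartAt (𝓡 n) p₀ (φ x) + w x) :=
    (contMDiffOn_extChartAt_symm p₀).contMDiffAt
      ((isOpen_extChartAt_target (I := 𝓡 n) p₀).mem_nhds ht)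
  refine (h2.comp x h1).congr_of_eventuallyEq ?_
  filter_upwards [hφ.continuousAt.preimage_mem_nhds
    ((isOpen_extChartAt_source (I := 𝓡 n) p₀).mem_nhds hx)] with z hz using patch_of_mem hz

/-- On the support of `w` the chart formula is smooth; off the support the map agrees with `φ` near
the point. The charted space `X` is general, so that the lemma also covers `ℝ × M`, that is, whole
variations. -/
theorem contMDiff_patch (hφ : ContMDiff I (𝓡 n) k φ)
    (hw : ContMDiff I 𝓘(ℝ, EuclideanSpace ℝ (Fin n)) k w)
    (hs : ∀ x ∈ tsupport w, φ x ∈ (extChartAt (𝓡 n) p₀).source)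
    (ht : ∀ x ∈ tsupport w, extChartAt (𝓡 n) p₀ (φ x) + w x ∈ (extChartAt (𝓡 n) p₀).target) :
    ContMDiff I (𝓡 n) k (patch p₀ φ w) := fun x => by
  by_cases hx : x ∈ tsupport w
  · exact contMDiffAt_patch (hφ x) (hw x) (hs x hx) (ht x hx)
  · exact (hφ x).congr_of_eventuallyEq (patch_eventuallyEq hx)

end Patch

/-! ### Chart-supported variations on a surface and smoothness of the coefficient. -/

section Surface

variable {n : ℕ} {M N : Type*}
  [TopologicalSpace M] [ChartedSpace (EuclideanSpace ℝ (Fin 2)) M] [IsManifold (𝓡 2) ∞ M]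
  [TopologicalSpace N] [ChartedSpace (EuclideanSpace ℝ (Fin n)) N] [IsManifold (𝓡 n) ∞ N]
  [RiemannianBundle (fun x : M => TangentSpace (𝓡 2) x)]

/-- A variation `patch p₀ φ (s • w)`, `|s| < δ`, of a smooth map `φ` on a surface, supported in an
oriented chart domain and in the preimage of a chart domain. -/
structure PatchVariation (o : ManifoldOrientation 2 M) (φ : M → N)
    (w : M → EuclideanSpace ℝ (Fin n)) (x₀ : M) (p₀ : N) (O : Set M) (ε δ : ℝ) : Prop where
  isOrientedPatch : IsOrientedPatch o x₀ O ε
  contMDiff : ContMDiff (𝓡 2) (𝓡 n) ∞ φ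
  contMDiff_field : ContMDiff (𝓡 2) 𝓘(ℝ, EuclideanSpace ℝ (Fin n)) ∞ w
  tsupport_subset : tsupport w ⊆ O
  map_mem : ∀ x ∈ tsupport w, φ x ∈ (extChartAt (𝓡 n) p₀).source
  mem_target : ∀ x ∈ tsupport w, ∀ s ∈ Ioo (-δ) δ,
    extChartAt (𝓡 n) p₀ (φ x) + s • w x ∈ (extChartAt (𝓡 n) p₀).target

omit [IsManifold (𝓡 n) ∞ N] in
theorem contDiffOn_formInChart (Ω : SymplecticForm n N) (p₀ : N) :
    ContDiffOn ℝ ∞ (formInChart Ω.toForm p₀) (extChartAt (𝓡 n) p₀).target := by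
  have h : ContDiff ℝ ∞ (fun α => toBilin (EuclideanSpace ℝ (Fin n)) α) :=
    ContinuousLinearMap.contDiff
      (F := EuclideanSpace ℝ (Fin n) →L[ℝ] EuclideanSpace ℝ (Fin n) →L[ℝ] ℝ) _
  exact h.comp_contDiffOn (Ω.smooth p₀)

variable (n) in
/-- The chart domain over which a map between manifolds is read in the charts around `x₀`, `p₀`. -/
def chartDomain (x₀ : M) (p₀ : N) (O : Set M) (φ : M → N) : Set (EuclideanSpace ℝ (Fin 2)) :=
  (extChartAt (𝓡 2) x₀).target ∩
    (extChartAt (𝓡 2) x₀).symm ⁻¹' (O ∩ φ ⁻¹' (extChartAt (𝓡 n) p₀).source)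

omit [IsManifold (𝓡 2) ∞ M] [IsManifold (𝓡 n) ∞ N]
  [RiemannianBundle (fun x : M => TangentSpace (𝓡 2) x)] in
theorem isOpen_chartDomain {x₀ : M} {p₀ : N} {O : Set M} {φ : M → N} (hO : IsOpen O)
    (hφ : Continuous φ) : IsOpen (chartDomain n x₀ p₀ O φ) :=
  (continuousOn_extChartAt_symm (I := 𝓡 2) x₀).isOpen_inter_preimage
    (isOpen_extChartAt_target (I := 𝓡 2) x₀)
    (hO.inter ((isOpen_extChartAt_source (I := 𝓡 n) p₀).preimage hφ))

omit [RiemannianBundle (fun x : M => TangentSpace (𝓡 2) x)] in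
theorem contDiffOn_inCharts {x₀ : M} {p₀ : N} {O : Set M} {φ : M → N}
    (hφ : ContMDiff (𝓡 2) (𝓡 n) ∞ φ) :
    ContDiffOn ℝ ∞ (inCharts (n := n) x₀ p₀ φ) (chartDomain n x₀ p₀ O φ) := by
  rw [← contMDiffOn_iff_contDiffOn]
  have h1 : ContMDiffOn 𝓘(ℝ, EuclideanSpace ℝ (Fin 2)) (𝓡 n) ∞
      (φ ∘ (extChartAt (𝓡 2) x₀).symm) (chartDomain n x₀ p₀ O φ) :=
    hφ.comp_contMDiffOn ((contMDiffOn_extChartAt_symm x₀).mono inter_subset_left)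
  exact (contMDiffOn_extChartAt (x := p₀)).comp h1 fun y hy => by
    simpa using hy.2.2

/-- The bridge that makes the vector space calculus of `LocalVariation` applicable on the manifold.
-/
theorem PatchVariation.localVariation [CompactSpace M] {o : ManifoldOrientation 2 M} {φ : M → N}
    {w : M → EuclideanSpace ℝ (Fin n)} {x₀ : M} {p₀ : N} {O : Set M} {ε δ : ℝ}
    (h : PatchVariation o φ w x₀ p₀ O ε δ) (Ω : SymplecticForm n N) :
    LocalVariation (formInChart Ω.toForm p₀) (extChartAt (𝓡 n) p₀).target (inCharts x₀ p₀ φ)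
      (fun y => w ((extChartAt (𝓡 2) x₀).symm y)) (chartDomain n x₀ p₀ O φ)
      (extChartAt (𝓡 2) x₀ '' tsupport w) δ where
  isOpen_target := isOpen_extChartAt_target p₀
  isOpen_source := isOpen_chartDomain h.isOrientedPatch.isOpen h.contMDiff.continuous
  isCompact := (isClosed_tsupport w).isCompact.image_of_continuousOn
    ((continuousOn_extChartAt (I := 𝓡 2) x₀).mono
      (h.tsupport_subset.trans h.isOrientedPatch.subset))
  subset := by
    rintro _ ⟨x, hx, rfl⟩
    have hxs := h.isOrientedPatch.subset (h.tsupport_subset hx)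
    refine ⟨(extChartAt (𝓡 2) x₀).map_source hxs, ?_⟩
    rw [mem_preimage, (extChartAt (𝓡 2) x₀).left_inv hxs]
    exact ⟨h.tsupport_subset hx, h.map_mem x hx⟩
  contDiffOn_form := contDiffOn_formInChart Ω p₀
  anti z _ a b := toBilin_swap _ a b
  closed z hz a b c := closed_toBilin
    (((Ω.smooth p₀).contDiffAt ((isOpen_extChartAt_target (I := 𝓡 n) p₀).mem_nhds
      hz)).differentiableAt (by simp)) (Ω.closed p₀ z hz) a b c
  contDiffOn := contDiffOn_inCharts h.contMDiff
  contDiffOn_field := by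
    rw [← contMDiffOn_iff_contDiffOn]
    exact h.contMDiff_field.comp_contMDiffOn
      ((contMDiffOn_extChartAt_symm x₀).mono inter_subset_left)
  field_eq_zero y hy := by
    by_contra hne
    refine hy.2 ⟨_, subset_tsupport w hne, (extChartAt (𝓡 2) x₀).right_inv hy.1.1⟩
  -- Off the support the increment is zero, so the condition on `tsupport w` suffices on the whole
  -- chart domain.
  mem y hy s hs := by
    by_cases hx : (extChartAt (𝓡 2) x₀).symm y ∈ tsupport w
    · exact h.mem_target _ hx s hs
    · rw [image_eq_zero_of_notMem_tsupport hx, smul_zero, add_zero]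
      exact (extChartAt (𝓡 n) p₀).map_source hy.2.2

/-- The function `k` with `ψ^*Ω = k vol`. -/
abbrev pullbackCoeff (o : ManifoldOrientation 2 M) (Ω : SymplecticForm n N) (ψ : M → N) : M → ℝ :=
  hodgeStarTwo o (pullback (m := 2) ψ Ω.toForm)

omit [IsManifold (𝓡 n) ∞ N] in
theorem pullbackCoeff_congr {o : ManifoldOrientation 2 M} {Ω : SymplecticForm n N} {ψ ψ' : M → N}
    {x : M} (h : ψ =ᶠ[𝓝 x] ψ') : pullbackCoeff o Ω ψ x = pullbackCoeff o Ω ψ' x := by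
  have e : ψ x = ψ' x := h.self_of_nhds
  have hm : (mfderiv (𝓡 2) (𝓡 n) ψ x : EuclideanSpace ℝ (Fin 2) →L[ℝ] EuclideanSpace ℝ (Fin n)) =
    mfderiv (𝓡 2) (𝓡 n) ψ' x := h.mfderiv_eq
  have key : ∀ (q : N) (L : EuclideanSpace ℝ (Fin 2) →L[ℝ] EuclideanSpace ℝ (Fin n)), q = ψ' x →
      L = mfderiv (𝓡 2) (𝓡 n) ψ' x → ∀ v : Fin 2 → EuclideanSpace ℝ (Fin 2),
      Ω.toForm q (fun i => L (v i)) =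
        Ω.toForm (ψ' x) (fun i => mfderiv (𝓡 2) (𝓡 n) ψ' x (v i)) := by
    rintro _ _ rfl rfl v; rfl
  exact key _ _ e hm _

theorem pullbackCoeff_eq {o : ManifoldOrientation 2 M} {x₀ : M} {O : Set M} {ε : ℝ}
    (h : IsOrientedPatch o x₀ O ε) {Ω : SymplecticForm n N} {ψ : M → N} {x : M} {p₀ : N}
    (hψ : MDifferentiableAt (𝓡 2) (𝓡 n) ψ x) (hx : x ∈ O)
    (hp : ψ x ∈ (extChartAt (𝓡 n) p₀).source) :
    pullbackCoeff o Ω ψ x = ε * (dens (formInChart Ω.toForm p₀) e₀ e₁ (inCharts x₀ p₀ ψ)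
      (extChartAt (𝓡 2) x₀ x) / density 2 x₀ x) := by
  rw [pullbackCoeff, h.hodgeStarTwo_eq _ hx, pullback_chartFrame hψ (h.subset hx) hp]

omit [RiemannianBundle (fun x : M => TangentSpace (𝓡 2) x)] in
theorem contDiffOn_dens_inCharts {Ω : SymplecticForm n N} {x₀ : M} {p₀ : N} {O : Set M} {φ : M → N}
    (hO : IsOpen O) (hφ : ContMDiff (𝓡 2) (𝓡 n) ∞ φ) :
    ContDiffOn ℝ ∞ (dens (formInChart Ω.toForm p₀) e₀ e₁ (inCharts x₀ p₀ φ))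
      (chartDomain n x₀ p₀ O φ) := by
  have hV := isOpen_chartDomain (n := n) (x₀ := x₀) (p₀ := p₀) hO hφ.continuous
  have hu : ContDiffOn ℝ ∞ (inCharts (n := n) x₀ p₀ φ) (chartDomain n x₀ p₀ O φ) :=
    contDiffOn_inCharts hφ
  have h1 : ContDiffOn ℝ ∞ (fun y => formInChart Ω.toForm p₀ (inCharts x₀ p₀ φ y))
      (chartDomain n x₀ p₀ O φ) :=
    (contDiffOn_formInChart Ω p₀).comp hu fun y hy => (extChartAt (𝓡 n) p₀).map_source hy.2.2
  have hd := hu.fderiv_of_isOpen (m := ∞) hV (by simp)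
  exact (h1.clm_apply (hd.clm_apply contDiffOn_const)).clm_apply (hd.clm_apply contDiffOn_const)

variable [IsContMDiffRiemannianBundle (𝓡 2) ∞ (EuclideanSpace ℝ (Fin 2))
      (fun x : M => TangentSpace (𝓡 2) x)]

theorem contDiffOn_coeff_inCharts {Ω : SymplecticForm n N} {x₀ : M} {p₀ : N} {O : Set M}
    {φ : M → N} (hO : IsOpen O) (hφ : ContMDiff (𝓡 2) (𝓡 n) ∞ φ) :
    ContDiffOn ℝ ∞ (fun y => dens (formInChart Ω.toForm p₀) e₀ e₁ (inCharts x₀ p₀ φ) y /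
      density 2 x₀ ((extChartAt (𝓡 2) x₀).symm y)) (chartDomain n x₀ p₀ O φ) :=
  (contDiffOn_dens_inCharts hO hφ).div ((contDiffOn_density_symm x₀).mono inter_subset_left)
    fun _ hy => (density_pos ((extChartAt (𝓡 2) x₀).map_target hy.1)).ne'

/-- Near each point the coefficient is a constant sign times a quotient of smooth functions with
positive denominator. -/
theorem contMDiff_pullbackCoeff (o : ManifoldOrientation 2 M) (Ω : SymplecticForm n N) {ψ : M → N}
    (hψ : ContMDiff (𝓡 2) (𝓡 n) ∞ ψ) :
    ContMDiff (𝓡 2) 𝓘(ℝ, ℝ) ∞ (pullbackCoeff o Ω ψ) := fun x₀ => by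
  obtain ⟨O, ε, hx₀, h⟩ := exists_isOrientedPatch o x₀
  have hp : ψ x₀ ∈ (extChartAt (𝓡 n) (ψ x₀)).source := mem_extChartAt_source _
  have hy : extChartAt (𝓡 2) x₀ x₀ ∈ chartDomain n x₀ (ψ x₀) O ψ := by
    refine ⟨mem_extChartAt_target x₀, ?_⟩
    rw [mem_preimage, extChartAt_to_inv]
    exact ⟨hx₀, hp⟩
  have h1 := (contDiffOn_coeff_inCharts (Ω := Ω) (x₀ := x₀) (p₀ := ψ x₀) h.isOpen hψ).contDiffAt
    ((isOpen_chartDomain (n := n) h.isOpen hψ.continuous).mem_nhds hy)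
  have h2 := (contDiffAt_const (c := ε)).mul h1
  refine (h2.contMDiffAt.comp x₀ (contMDiffAt_extChartAt (I := 𝓡 2))).congr_of_eventuallyEq ?_
  filter_upwards [h.isOpen.mem_nhds hx₀, hψ.continuous.continuousAt.preimage_mem_nhds
    ((isOpen_extChartAt_source (I := 𝓡 n) (ψ x₀)).mem_nhds hp)] with x hx hpx
  rw [pullbackCoeff_eq h (hψ.mdifferentiableAt (by simp)) hx hpx]
  simp only [Function.comp_apply]
  rw [(extChartAt (𝓡 2) x₀).left_inv (h.subset hx)]

end Surface

/-! ### Variation of weighted integrals and of the energy. -/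

section Functional

variable {n : ℕ} {M N : Type*}
  [TopologicalSpace M] [ChartedSpace (EuclideanSpace ℝ (Fin 2)) M] [IsManifold (𝓡 2) ∞ M]
  [TopologicalSpace N] [ChartedSpace (EuclideanSpace ℝ (Fin n)) N] [IsManifold (𝓡 n) ∞ N]
  [RiemannianBundle (fun x : M => TangentSpace (𝓡 2) x)]
  {o : ManifoldOrientation 2 M} {φ : M → N}
  {w : M → EuclideanSpace ℝ (Fin n)} {x₀ : M} {p₀ : N} {O : Set M} {ε δ : ℝ}

theorem tsupport_smul_subset {X : Type*} [TopologicalSpace X] {F : Type*} [NormedAddCommGroup F]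
    [NormedSpace ℝ F] (s : ℝ) (w : X → F) : tsupport (s • w) ⊆ tsupport w :=
  closure_mono fun x hx hw => hx (by simp [hw])

omit [IsManifold (𝓡 n) ∞ N] in
theorem energy_eq [MeasurableSpace M] (Ω : SymplecticForm n N) (o : ManifoldOrientation 2 M)
    (ψ : M → N) :
    energy (m := 2) Ω ψ = 1 / 2 * ∫ x, pullbackCoeff o Ω ψ x ^ 2 ∂(riemannianVolume 2 M) := by
  rw [energy]
  congr 2
  ext x
  exact normSq_eq_hodgeStarTwo_sq o _ x

namespace PatchVariation

theorem contMDiff_patch (h : PatchVariation o φ w x₀ p₀ O ε δ) {s : ℝ} (hs : s ∈ Ioo (-δ) δ) :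
    ContMDiff (𝓡 2) (𝓡 n) ∞ (patch p₀ φ (s • w)) :=
  SymplecticEnergy.contMDiff_patch h.contMDiff
    ((contMDiff_const (I' := 𝓘(ℝ, ℝ))).smul h.contMDiff_field)
    (fun x hx => h.map_mem x (tsupport_smul_subset s w hx))
    (fun x hx => h.mem_target x (tsupport_smul_subset s w hx) s hs)

theorem pullbackCoeff_patch (h : PatchVariation o φ w x₀ p₀ O ε δ) (Ω : SymplecticForm n N)
    {s : ℝ} (hs : s ∈ Ioo (-δ) δ) {x : M} (hx : x ∈ tsupport w) :
    pullbackCoeff o Ω (patch p₀ φ (s • w)) x =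
      ε * (dens (formInChart Ω.toForm p₀) e₀ e₁
        (fun y => inCharts x₀ p₀ φ y + s • w ((extChartAt (𝓡 2) x₀).symm y))
        (extChartAt (𝓡 2) x₀ x) / density 2 x₀ x) := by
  have hxO := h.tsupport_subset hx
  have hxs := h.isOrientedPatch.subset hxO
  have hmem : ∀ z, φ z ∈ (extChartAt (𝓡 n) p₀).source →
      extChartAt (𝓡 n) p₀ (φ z) + (s • w) z ∈ (extChartAt (𝓡 n) p₀).target := by
    intro z hz
    by_cases hzw : z ∈ tsupport w
    · exact h.mem_target z hzw s hs
    · rw [Pi.smul_apply, image_eq_zero_of_notMem_tsupport hzw, smul_zero, add_zero]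
      exact (extChartAt (𝓡 n) p₀).map_source hz
  rw [pullbackCoeff_eq h.isOrientedPatch ((h.contMDiff_patch hs).mdifferentiableAt (by simp)) hxO
    (patch_mem_source (h.map_mem x hx) (hmem x (h.map_mem x hx)))]
  have hy : extChartAt (𝓡 2) x₀ x ∈ chartDomain n x₀ p₀ O φ := by
    refine ⟨(extChartAt (𝓡 2) x₀).map_source hxs, ?_⟩
    rw [mem_preimage, (extChartAt (𝓡 2) x₀).left_inv hxs]
    exact ⟨hxO, h.map_mem x hx⟩
  have hev : inCharts x₀ p₀ (patch p₀ φ (s • w)) =ᶠ[𝓝 (extChartAt (𝓡 2) x₀ x)]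
      fun y => inCharts x₀ p₀ φ y + s • w ((extChartAt (𝓡 2) x₀).symm y) := by
    filter_upwards [(isOpen_chartDomain h.isOrientedPatch.isOpen
      h.contMDiff.continuous).mem_nhds hy] with y hy
    exact extChartAt_patch hy.2.2 (hmem _ hy.2.2)
  rw [dens, dens, hev.fderiv_eq, hev.self_of_nhds]

omit [IsManifold (𝓡 n) ∞ N] in
theorem pullbackCoeff_patch_of_notMem (Ω : SymplecticForm n N) (s : ℝ) {x : M}
    (hx : x ∉ tsupport w) :
    pullbackCoeff o Ω (patch p₀ φ (s • w)) x = pullbackCoeff o Ω φ x :=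
  pullbackCoeff_congr (patch_eventuallyEq fun h => hx (tsupport_smul_subset s w h))

variable [IsContMDiffRiemannianBundle (𝓡 2) ∞ (EuclideanSpace ℝ (Fin 2))
      (fun x : M => TangentSpace (𝓡 2) x)]
  [CompactSpace M] [T2Space M] [MeasurableSpace M] [BorelSpace M]

omit [IsManifold (𝓡 n) ∞ N] in
theorem _root_.SymplecticEnergy.integrable_riemannianVolume {g : M → ℝ} (hg : Continuous g) :
    Integrable g (riemannianVolume 2 M) := by
  have := ChartedSpace.secondCountable_of_sigmaCompact (EuclideanSpace ℝ (Fin 2)) M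
  have := isFiniteMeasure_riemannianVolume (m := 2) (M := M)
  rw [← integrableOn_univ]
  exact hg.continuousOn.integrableOn_compact isCompact_univ

/-- On the support, the density of the volume cancels the one dividing the coefficient, so the
metric drops out; the rest of the surface contributes a term independent of `s`. -/
theorem integral_mul_pullbackCoeff_patch (h : PatchVariation o φ w x₀ p₀ O ε δ)
    (Ω : SymplecticForm n N) {g : M → ℝ} (hg : Continuous g) {s : ℝ} (hs : s ∈ Ioo (-δ) δ) :
    ∫ x, g x * pullbackCoeff o Ω (patch p₀ φ (s • w)) x ∂(riemannianVolume 2 M) =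
      (∫ y in extChartAt (𝓡 2) x₀ '' tsupport w, (ε * g ((extChartAt (𝓡 2) x₀).symm y)) *
        dens (formInChart Ω.toForm p₀) e₀ e₁
        (fun y => inCharts x₀ p₀ φ y + s • w ((extChartAt (𝓡 2) x₀).symm y)) y) +
      ∫ x in (tsupport w)ᶜ, g x * pullbackCoeff o Ω φ x ∂(riemannianVolume 2 M) := by
  have := ChartedSpace.secondCountable_of_sigmaCompact (EuclideanSpace ℝ (Fin 2)) M
  have hc : Continuous fun x => g x * pullbackCoeff o Ω (patch p₀ φ (s • w)) x :=
    hg.mul (contMDiff_pullbackCoeff o Ω (h.contMDiff_patch hs)).continuous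
  have hK := (isClosed_tsupport w).isCompact
  have hKs := h.tsupport_subset.trans h.isOrientedPatch.subset
  have hKc : IsCompact (extChartAt (𝓡 2) x₀ '' tsupport w) := (h.localVariation Ω).isCompact
  rw [← integral_add_compl (isClosed_tsupport w).measurableSet (integrable_riemannianVolume hc)]
  congr 1
  · rw [setIntegral_riemannianVolume hK hKs hc.continuousOn]
    refine setIntegral_congr_fun hKc.measurableSet ?_
    rintro _ ⟨x, hx, rfl⟩
    simp only
    rw [(extChartAt (𝓡 2) x₀).left_inv (hKs hx), h.pullbackCoeff_patch Ω hs hx]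
    have := (density_pos (hKs hx)).ne'
    field_simp
  · refine setIntegral_congr_fun (isClosed_tsupport w).measurableSet.compl fun x hx => ?_
    rw [pullbackCoeff_patch_of_notMem Ω s hx]

/-- Squaring the coefficient leaves one inverse density uncancelled and removes the sign, as `ε² =
1`. -/
theorem integral_pullbackCoeff_patch_sq (h : PatchVariation o φ w x₀ p₀ O ε δ)
    (Ω : SymplecticForm n N) {s : ℝ} (hs : s ∈ Ioo (-δ) δ) :
    ∫ x, pullbackCoeff o Ω (patch p₀ φ (s • w)) x ^ 2 ∂(riemannianVolume 2 M) =
      (∫ y in extChartAt (𝓡 2) x₀ '' tsupport w, (density 2 x₀ ((extChartAt (𝓡 2) x₀).symm y))⁻¹ *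
        dens (formInChart Ω.toForm p₀) e₀ e₁
        (fun y => inCharts x₀ p₀ φ y + s • w ((extChartAt (𝓡 2) x₀).symm y)) y ^ 2) +
      ∫ x in (tsupport w)ᶜ, pullbackCoeff o Ω φ x ^ 2 ∂(riemannianVolume 2 M) := by
  have := ChartedSpace.secondCountable_of_sigmaCompact (EuclideanSpace ℝ (Fin 2)) M
  have hc : Continuous fun x => pullbackCoeff o Ω (patch p₀ φ (s • w)) x ^ 2 :=
    (contMDiff_pullbackCoeff o Ω (h.contMDiff_patch hs)).continuous.pow 2
  have hK := (isClosed_tsupport w).isCompact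
  have hKs := h.tsupport_subset.trans h.isOrientedPatch.subset
  have hKc : IsCompact (extChartAt (𝓡 2) x₀ '' tsupport w) := (h.localVariation Ω).isCompact
  rw [← integral_add_compl (isClosed_tsupport w).measurableSet (integrable_riemannianVolume hc)]
  congr 1
  · rw [setIntegral_riemannianVolume hK hKs hc.continuousOn]
    refine setIntegral_congr_fun hKc.measurableSet ?_
    rintro _ ⟨x, hx, rfl⟩
    simp only
    rw [(extChartAt (𝓡 2) x₀).left_inv (hKs hx), h.pullbackCoeff_patch Ω hs hx]
    have := (density_pos (hKs hx)).ne'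
    have hε : ε ^ 2 = 1 := by rw [sq, h.isOrientedPatch.sq_eq]
    field_simp
    rw [hε]
    ring
  · refine setIntegral_congr_fun (isClosed_tsupport w).measurableSet.compl fun x hx => ?_
    rw [pullbackCoeff_patch_of_notMem Ω s hx]

/-- For a locally constant weight `f`, the integral of `f φ^*Ω` does not change along a variation
supported in a chart. -/
theorem integral_mul_pullbackCoeff_patch_eq (h : PatchVariation o φ w x₀ p₀ O ε δ) (hδ : 1 < δ)
    (Ω : SymplecticForm n N) {f : M → ℝ} (hf : IsLocallyConstant f) :
    ∫ x, f x * pullbackCoeff o Ω (patch p₀ φ w) x ∂(riemannianVolume 2 M) =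
      ∫ x, f x * pullbackCoeff o Ω φ x ∂(riemannianVolume 2 M) := by
  set L := h.localVariation Ω
  set F : EuclideanSpace ℝ (Fin 2) → ℝ := fun y => ε * f ((extChartAt (𝓡 2) x₀).symm y) with hF
  have hloc : ∀ y ∈ chartDomain n x₀ p₀ O φ, F =ᶠ[𝓝 y] fun _ => F y := by
    intro y hy
    have hc : ContinuousAt (extChartAt (𝓡 2) x₀).symm y :=
      continuousAt_extChartAt_symm'' (I := 𝓡 2) hy.1
    filter_upwards [hc.preimage_mem_nhds
      (hf.isOpen_fiber (f ((extChartAt (𝓡 2) x₀).symm y)) |>.mem_nhds rfl)] with z hz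
    exact congrArg (ε * ·) hz
  have hF1 : ContDiffOn ℝ 1 F (chartDomain n x₀ p₀ O φ) := fun y hy =>
    (contDiffAt_const.congr_of_eventuallyEq (hloc y hy)).contDiffWithinAt
  have hF' : ∀ y ∈ chartDomain n x₀ p₀ O φ, fderiv ℝ F y = 0 := fun y hy => by
    rw [(hloc y hy).fderiv_eq]; simp
  set Q : ℝ → ℝ := fun s => ∫ x, f x * pullbackCoeff o Ω (patch p₀ φ (s • w)) x
    ∂(riemannianVolume 2 M) with hQ
  have hder : ∀ s ∈ Ioo (-δ) δ, HasDerivAt Q 0 s := by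
    intro s hs
    have h1 := (L.hasDerivAt_setIntegral_mul_dens (μ := volume) (e₁ := e₀) (e₂ := e₁)
      (hF1.continuousOn.mono L.subset) hs).add_const
        (∫ x in (tsupport w)ᶜ, f x * pullbackCoeff o Ω φ x ∂(riemannianVolume 2 M))
    rw [L.setIntegral_mul_densDeriv hF1 hs] at h1
    have h0 : ∫ y in extChartAt (𝓡 2) x₀ '' tsupport w,
        (fderiv ℝ F y e₁ * contr (formInChart Ω.toForm p₀)
          (fun y => inCharts x₀ p₀ φ y + s • w ((extChartAt (𝓡 2) x₀).symm y))
          (fun y => w ((extChartAt (𝓡 2) x₀).symm y)) e₀ y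
        - fderiv ℝ F y e₀ * contr (formInChart Ω.toForm p₀)
          (fun y => inCharts x₀ p₀ φ y + s • w ((extChartAt (𝓡 2) x₀).symm y))
          (fun y => w ((extChartAt (𝓡 2) x₀).symm y)) e₁ y) = 0 := by
      rw [setIntegral_congr_fun (g := fun _ => (0 : ℝ)) L.isCompact.measurableSet]
      · simp
      · intro y hy
        simp [hF' y (L.subset hy)]
    rw [h0] at h1
    refine h1.congr_of_eventuallyEq ?_
    filter_upwards [isOpen_Ioo.mem_nhds hs] with t ht
    exact h.integral_mul_pullbackCoeff_patch Ω hf.continuous ht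
  -- Here `1 < δ` is needed: the move must be admissible for all parameters from 0 to 1.
  have hsub : Icc (0 : ℝ) 1 ⊆ Ioo (-δ) δ := fun s hs => ⟨by linarith [hs.1], by linarith [hs.2]⟩
  have key := constant_of_has_deriv_right_zero (f := Q) (a := 0) (b := 1)
    (fun s hs => (hder s (hsub hs)).continuousAt.continuousWithinAt)
    (fun s hs => (hder s (hsub (Ico_subset_Icc_self hs))).hasDerivWithinAt) 1 ⟨zero_le_one, le_rfl⟩
  simp only [hQ, one_smul, zero_smul] at key
  rw [key]
  rw [patch_zero]

/-- The first variation of the energy. -/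
theorem hasDerivAt_energy (h : PatchVariation o φ w x₀ p₀ O ε δ) (hδ : 0 < δ)
    (Ω : SymplecticForm n N) :
    HasDerivAt (fun s : ℝ => energy (m := 2) Ω (patch p₀ φ (s • w)))
      (∫ y in extChartAt (𝓡 2) x₀ '' tsupport w,
        (fderiv ℝ (fun y => dens (formInChart Ω.toForm p₀) e₀ e₁ (inCharts x₀ p₀ φ) y /
            density 2 x₀ ((extChartAt (𝓡 2) x₀).symm y)) y e₁ *
          contr (formInChart Ω.toForm p₀) (inCharts x₀ p₀ φ)
            (fun y => w ((extChartAt (𝓡 2) x₀).symm y)) e₀ y -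
        fderiv ℝ (fun y => dens (formInChart Ω.toForm p₀) e₀ e₁ (inCharts x₀ p₀ φ) y /
            density 2 x₀ ((extChartAt (𝓡 2) x₀).symm y)) y e₀ *
          contr (formInChart Ω.toForm p₀) (inCharts x₀ p₀ φ)
            (fun y => w ((extChartAt (𝓡 2) x₀).symm y)) e₁ y)) 0 := by
  set L := h.localVariation Ω
  have h0 : (0 : ℝ) ∈ Ioo (-δ) δ := ⟨by linarith, hδ⟩
  have hρ : ContinuousOn (fun y => (density 2 x₀ ((extChartAt (𝓡 2) x₀).symm y))⁻¹)
      (extChartAt (𝓡 2) x₀ '' tsupport w) := by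
    refine (((contDiffOn_density_symm x₀).continuousOn).inv₀ fun y hy => ?_).mono
      (L.subset.trans inter_subset_left)
    exact (density_pos ((extChartAt (𝓡 2) x₀).map_target hy)).ne'
  have h1 := ((L.hasDerivAt_setIntegral_mul_dens_sq (μ := volume) (e₁ := e₀) (e₂ := e₁)
    hρ h0).add_const (∫ x in (tsupport w)ᶜ, pullbackCoeff o Ω φ x ^ 2
      ∂(riemannianVolume 2 M))).const_mul (1 / 2)
  have h2 := L.setIntegral_mul_densDeriv (μ := volume) (e₁ := e₀) (e₂ := e₁)
    ((contDiffOn_coeff_inCharts (Ω := Ω) (x₀ := x₀) (p₀ := p₀) h.isOrientedPatch.isOpen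
      h.contMDiff).of_le (WithTop.coe_le_coe.2 le_top)) h0
  have hz : (fun y => inCharts x₀ p₀ φ y + (0 : ℝ) • w ((extChartAt (𝓡 2) x₀).symm y)) =
      inCharts x₀ p₀ φ := by ext1 y; simp
  rw [hz] at h1 h2
  rw [← h2]
  refine (h1.congr_of_eventuallyEq ?_).congr_deriv ?_
  · filter_upwards [isOpen_Ioo.mem_nhds h0] with t ht
    rw [energy_eq Ω o, h.integral_pullbackCoeff_patch_sq Ω ht]
  · rw [← mul_assoc, one_div_mul_cancel two_ne_zero, one_mul]
    refine setIntegral_congr_fun L.isCompact.measurableSet fun y _ => ?_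
    rw [div_eq_inv_mul]

end PatchVariation

end Functional

/-! ### Criteria for local constancy. -/

section LocallyConstant

variable {m : ℕ} {M : Type*} [TopologicalSpace M] [ChartedSpace (EuclideanSpace ℝ (Fin m)) M]
  [IsManifold (𝓡 m) ∞ M]

theorem isLocallyConstant_of_hasMFDerivAt_zero {g : M → ℝ}
    (hg : ∀ x, HasMFDerivAt (𝓡 m) 𝓘(ℝ, ℝ) g x
      (0 : EuclideanSpace ℝ (Fin m) →L[ℝ] ℝ)) : IsLocallyConstant g := by
  rw [IsLocallyConstant.iff_eventually_eq]
  intro x₀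
  set e := extChartAt (𝓡 m) x₀ with he
  have hT : IsOpen e.target := isOpen_extChartAt_target x₀
  obtain ⟨r, hr, hrT⟩ := Metric.isOpen_iff.1 hT (e x₀) (mem_extChartAt_target x₀)
  have hd : ∀ y ∈ e.target, HasFDerivAt (g ∘ e.symm) (0 : EuclideanSpace ℝ (Fin m) →L[ℝ] ℝ) y := by
    intro y hy
    have h1 := (hg (e.symm y)).comp y (mdifferentiableAt_extChartAt_symm hy).hasMFDerivAt
    have h2 : HasMFDerivAt (𝓡 m) 𝓘(ℝ, ℝ) (g ∘ e.symm) y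
        (0 : EuclideanSpace ℝ (Fin m) →L[ℝ] ℝ) := by
      refine h1.congr_mfderiv ?_
      exact ContinuousLinearMap.zero_comp _
    exact hasMFDerivAt_iff_hasFDerivAt.1 h2
  have hconst : ∀ y ∈ Metric.ball (e x₀) r, (g ∘ e.symm) y = (g ∘ e.symm) (e x₀) := by
    intro y hy
    refine Metric.isOpen_ball.is_const_of_fderiv_eq_zero (𝕜 := ℝ)
      (convex_ball (e x₀) r).isPreconnected
      (fun z hz => (hd z (hrT hz)).differentiableAt.differentiableWithinAt)
      (fun z hz => (hd z (hrT hz)).fderiv) hy (Metric.mem_ball_self hr)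
  have hc : ContinuousAt e x₀ := continuousAt_extChartAt x₀
  filter_upwards [hc.preimage_mem_nhds (Metric.ball_mem_nhds _ hr),
    extChartAt_source_mem_nhds (I := 𝓡 m) x₀] with x hx hxs
  have := hconst (e x) hx
  rwa [Function.comp_apply, Function.comp_apply, e.left_inv hxs,
    e.left_inv (mem_extChartAt_source x₀)] at this

/-- Near a zero, `f²` vanishes and so does `f`. Elsewhere `f` is locally `± f x`, and continuity
excludes the change of sign. -/
theorem isLocallyConstant_of_sq {X : Type*} [TopologicalSpace X] {f : X → ℝ} (hf : Continuous f)
    (h : IsLocallyConstant fun x => f x ^ 2) : IsLocallyConstant f := by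
  rw [IsLocallyConstant.iff_eventually_eq] at h ⊢
  intro x
  by_cases hx : f x = 0
  · filter_upwards [h x] with z hz
    rw [hx, zero_pow two_ne_zero] at hz
    rw [hx]; exact pow_eq_zero_iff two_ne_zero |>.1 hz
  · have hpos : 0 < f x * f x := mul_self_pos.2 hx
    have hc : ContinuousAt (fun z => f z * f x) x := (hf.mul continuous_const).continuousAt
    filter_upwards [h x, hc.eventually (lt_mem_nhds hpos)] with z hz hz'
    rcases sq_eq_sq_iff_eq_or_eq_neg.1 hz with h1 | h1
    · exact h1
    · rw [h1] at hz'; nlinarith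

end LocallyConstant

/-! ### The Euler-Lagrange equation and its consequence `k dk = 0`. -/

section Critical

variable {n : ℕ} {M N : Type*}
  [TopologicalSpace M] [ChartedSpace (EuclideanSpace ℝ (Fin 2)) M] [IsManifold (𝓡 2) ∞ M]
  [TopologicalSpace N] [ChartedSpace (EuclideanSpace ℝ (Fin n)) N] [IsManifold (𝓡 n) ∞ N]

theorem formInChart_nondegenerate (Ω : SymplecticForm n N) {p p₀ : N}
    (hp : p ∈ (extChartAt (𝓡 n) p₀).source) {z : EuclideanSpace ℝ (Fin n)}
    (hz : ∀ v, formInChart Ω.toForm p₀ (extChartAt (𝓡 n) p₀ p) v z = 0) : z = 0 := by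
  have h1 : chartFrame n p₀ p z = 0 := by
    refine Ω.nondegenerate p _ fun w => ?_
    obtain ⟨v, rfl⟩ := (chartFrameEquiv hp).surjective w
    rw [chartFrameEquiv_apply, alternating_swap, ← inChart_extChartAt_apply hp, ← toBilin_apply]
    exact neg_eq_zero.2 (hz v)
  rw [← chartFrameEquiv_apply hp] at h1
  exact (chartFrameEquiv hp).map_eq_zero_iff.1 h1

variable [RiemannianBundle (fun x : M => TangentSpace (𝓡 2) x)]
  [IsContMDiffRiemannianBundle (𝓡 2) ∞ (EuclideanSpace ℝ (Fin 2))
      (fun x : M => TangentSpace (𝓡 2) x)]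
  [CompactSpace M] [T2Space M] [MeasurableSpace M] [BorelSpace M]
  {o : ManifoldOrientation 2 M} {Ω : SymplecticForm n N} {φ : M → N}
  {w : M → EuclideanSpace ℝ (Fin n)} {x₀ : M} {p₀ : N} {O : Set M} {ε δ : ℝ}

omit [IsContMDiffRiemannianBundle (𝓡 2) ∞ (EuclideanSpace ℝ (Fin 2))
      (fun x : M => TangentSpace (𝓡 2) x)] [CompactSpace M] [T2Space M] [BorelSpace M] in
-- A critical point is tested only on variations defined for all real times, whereas the patch is
-- admissible for `|s| < δ`. The substitution `s = (δ / 2) sin t` repairs this and has nonzero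
-- derivative `δ / 2` at 0.
theorem PatchVariation.deriv_energy_eq_zero (h : PatchVariation o φ w x₀ p₀ O ε δ) (hδ : 0 < δ)
    (hφ : IsCriticalPoint (m := 2) Ω φ) {D : ℝ}
    (hD : HasDerivAt (fun s : ℝ => energy (m := 2) Ω (patch p₀ φ (s • w))) D 0) : D = 0 := by
  set c : ℝ → ℝ := fun t => δ / 2 * Real.sin t with hc
  have hcm : ∀ t, c t ∈ Ioo (-δ) δ := fun t => by
    have h1 := Real.sin_le_one t
    have h2 := Real.neg_one_le_sin t
    constructor <;> simp only [hc] <;> nlinarith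
  have hcs : ContDiff ℝ ∞ c := contDiff_const.mul Real.contDiff_sin
  have hsub : tsupport (fun p : ℝ × M => c p.1 • w p.2) ⊆ Prod.snd ⁻¹' tsupport w :=
    closure_minimal (fun p hp => subset_tsupport w fun h0 => hp (by simp [h0]))
      ((isClosed_tsupport w).preimage continuous_snd)
  have hΦ : ContMDiff (𝓘(ℝ, ℝ).prod (𝓡 2)) (𝓡 n) ∞
      (patch p₀ (fun p : ℝ × M => φ p.2) (fun p : ℝ × M => c p.1 • w p.2)) :=
    SymplecticEnergy.contMDiff_patch (h.contMDiff.comp contMDiff_snd)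
      ((hcs.contMDiff.comp contMDiff_fst).smul (h.contMDiff_field.comp contMDiff_snd))
      (fun p hp => h.map_mem _ (hsub hp)) (fun p hp => h.mem_target _ (hsub hp) _ (hcm p.1))
  have h1 := hφ.2 (fun t => patch p₀ φ (c t • w)) hΦ (by
    simp only [hc, Real.sin_zero, mul_zero, zero_smul]; exact patch_zero)
  have hc0 : c 0 = 0 := by simp [hc]
  have h2 : HasDerivAt c (δ / 2) 0 := by
    simpa using (Real.hasDerivAt_sin 0).const_mul (δ / 2)
  have h3 := HasDerivAt.comp (h₂ := fun s : ℝ => energy (m := 2) Ω (patch p₀ φ (s • w))) 0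
    (by rw [hc0]; exact hD) h2
  have h4 := h3.unique h1
  have : δ / 2 ≠ 0 := by positivity
  exact (mul_eq_zero.1 h4).resolve_right this

/-- The Euler-Lagrange equation at the centre of a chart. -/
theorem eulerLagrange (hφ : IsCriticalPoint (m := 2) Ω φ) (hO : IsOrientedPatch o x₀ O ε)
    (hx₀ : x₀ ∈ O) (v : EuclideanSpace ℝ (Fin n)) :
    fderiv ℝ (fun y => dens (formInChart Ω.toForm (φ x₀)) e₀ e₁ (inCharts x₀ (φ x₀) φ) y /
        density 2 x₀ ((extChartAt (𝓡 2) x₀).symm y)) (extChartAt (𝓡 2) x₀ x₀) e₁ *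
      formInChart Ω.toForm (φ x₀) (inCharts x₀ (φ x₀) φ (extChartAt (𝓡 2) x₀ x₀)) v
        (fderiv ℝ (inCharts x₀ (φ x₀) φ) (extChartAt (𝓡 2) x₀ x₀) e₀) -
    fderiv ℝ (fun y => dens (formInChart Ω.toForm (φ x₀)) e₀ e₁ (inCharts x₀ (φ x₀) φ) y /
        density 2 x₀ ((extChartAt (𝓡 2) x₀).symm y)) (extChartAt (𝓡 2) x₀ x₀) e₀ *
      formInChart Ω.toForm (φ x₀) (inCharts x₀ (φ x₀) φ (extChartAt (𝓡 2) x₀ x₀)) v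
        (fderiv ℝ (inCharts x₀ (φ x₀) φ) (extChartAt (𝓡 2) x₀ x₀) e₁) = 0 := by
  set p₀ := φ x₀ with hp₀
  set e := extChartAt (𝓡 2) x₀ with he
  set B := formInChart Ω.toForm p₀ with hB
  set u := inCharts (m := 2) (n := n) x₀ p₀ φ with hu
  set F := fun y => dens B e₀ e₁ u y / density 2 x₀ (e.symm y) with hF
  set c : EuclideanSpace ℝ (Fin n) → EuclideanSpace ℝ (Fin 2) → ℝ := fun v y =>
    fderiv ℝ F y e₁ * B (u y) v (fderiv ℝ u y e₀) - fderiv ℝ F y e₀ * B (u y) v (fderiv ℝ u y e₁)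
    with hc
  change c v (e x₀) = 0
  set V := chartDomain n x₀ p₀ O φ with hV
  have hVo : IsOpen V := isOpen_chartDomain hO.isOpen hφ.1.continuous
  have hps : p₀ ∈ (extChartAt (𝓡 n) p₀).source := mem_extChartAt_source _
  have hyV : e x₀ ∈ V := by
    refine ⟨mem_extChartAt_target x₀, ?_⟩
    rw [mem_preimage, extChartAt_to_inv]
    exact ⟨hx₀, hps⟩
  have hcc : ∀ v, ContinuousOn (c v) V := by
    intro v
    have d1 := (contDiffOn_coeff_inCharts (Ω := Ω) (x₀ := x₀) (p₀ := p₀) hO.isOpen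
      hφ.1).continuousOn_fderiv_of_isOpen hVo (by simp)
    have u1 : ContDiffOn ℝ ∞ u V := contDiffOn_inCharts hφ.1
    have d2 := u1.continuousOn_fderiv_of_isOpen hVo (by simp)
    have b1 : ContinuousOn (fun y => B (u y)) V :=
      (contDiffOn_formInChart Ω p₀).continuousOn.comp u1.continuousOn
        fun y hy => (extChartAt (𝓡 n) p₀).map_source hy.2.2
    exact ((d1.clm_apply continuousOn_const).mul ((b1.clm_apply continuousOn_const).clm_apply
      (d2.clm_apply continuousOn_const))).sub ((d1.clm_apply continuousOn_const).mul
      ((b1.clm_apply continuousOn_const).clm_apply (d2.clm_apply continuousOn_const)))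
  have hneg : ∀ v y, c (-v) y = -c v y := fun v y => by simp [hc]; ring
  -- The expression is odd in `v`, so excluding positive values for every `v` is enough.
  suffices hmain : ∀ v, ¬ 0 < c v (e x₀) by
    refine le_antisymm (not_lt.1 (hmain v)) ?_
    have := not_lt.1 (hmain (-v))
    rw [hneg] at this
    linarith
  intro v hpos
  have hW : {y | y ∈ V ∧ 0 < c v y} ∈ 𝓝 (e x₀) := by
    filter_upwards [hVo.mem_nhds hyV,
      ((hcc v).continuousAt (hVo.mem_nhds hyV)).eventually (lt_mem_nhds hpos)] with y h1 h2
    exact ⟨h1, h2⟩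
  have hWM : {x | x ∈ O ∧ φ x ∈ (extChartAt (𝓡 n) p₀).source ∧ 0 < c v (e x)} ∈ 𝓝 x₀ := by
    have hce : ContinuousAt e x₀ := continuousAt_extChartAt x₀
    filter_upwards [hO.isOpen.mem_nhds hx₀, hφ.1.continuous.continuousAt.preimage_mem_nhds
      ((isOpen_extChartAt_source (I := 𝓡 n) p₀).mem_nhds hps), hce.preimage_mem_nhds hW]
      with x h1 h2 h3
    exact ⟨h1, h2, h3.2⟩
  obtain ⟨f, -, hf⟩ := (SmoothBumpFunction.nhds_basis_tsupport (I := 𝓡 2) x₀).mem_iff.1 hWM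
  set w : M → EuclideanSpace ℝ (Fin n) := fun x => f x • v with hw
  have hwsub : tsupport w ⊆ tsupport f := closure_mono fun x hx h0 => hx (by simp [hw, h0])
  have hφc : IsCompact ((fun x => extChartAt (𝓡 n) p₀ (φ x)) '' tsupport f) := by
    refine (isClosed_tsupport _).isCompact.image_of_continuousOn ?_
    exact (continuousOn_extChartAt (I := 𝓡 n) p₀).comp hφ.1.continuous.continuousOn
      fun x hx => (hf hx).2.1
  obtain ⟨δ, hδ, hδT⟩ := hφc.exists_thickening_subset_open
    (isOpen_extChartAt_target (I := 𝓡 n) p₀) (by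
      rintro _ ⟨x, hx, rfl⟩
      exact (extChartAt (𝓡 n) p₀).map_source (hf hx).2.1)
  -- With `|s|` below this bound, `s f v` is shorter than `δ`, the radius of a thickening of the
  -- compact image that stays in the chart target.
  have hδ' : 0 < δ / (‖v‖ + 1) := by positivity
  have hvar : PatchVariation o φ w x₀ p₀ O ε (δ / (‖v‖ + 1)) :=
    { isOrientedPatch := hO
      contMDiff := hφ.1
      contMDiff_field := f.contMDiff.smul contMDiff_const
      tsupport_subset := fun x hx => (hf (hwsub hx)).1
      map_mem := fun x hx => (hf (hwsub hx)).2.1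
      mem_target := fun x hx s hs => by
        refine hδT (Metric.mem_thickening_iff.2 ⟨_, ⟨x, hwsub hx, rfl⟩, ?_⟩)
        rw [dist_eq_norm, add_sub_cancel_left, hw, norm_smul, norm_smul, Real.norm_eq_abs]
        have h1 : ‖f x‖ ≤ 1 := by
          rw [Real.norm_eq_abs, abs_of_nonneg f.nonneg]; exact f.le_one
        have h2 : |s| < δ / (‖v‖ + 1) := abs_lt.2 hs
        calc |s| * (‖f x‖ * ‖v‖) ≤ |s| * (1 * ‖v‖) := by gcongr
          _ ≤ |s| * (‖v‖ + 1) := by rw [one_mul]; gcongr; linarith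
          _ < δ / (‖v‖ + 1) * (‖v‖ + 1) := by gcongr
          _ = δ := by field_simp }
  have hzero := hvar.deriv_energy_eq_zero hδ' hφ (hvar.hasDerivAt_energy hδ' Ω)
  have hcontr : ∀ a y, contr B u (fun y => w (e.symm y)) a y =
      f (e.symm y) * B (u y) v (fderiv ℝ u y a) := fun a y => by
    simp [contr, hw]
  set K := e '' tsupport w with hK
  have L := hvar.localVariation Ω
  have hKc : IsCompact K := L.isCompact
  have hzero' : ∫ y in K, f (e.symm y) * c v y = 0 := by
    rw [← hzero]
    refine setIntegral_congr_fun hKc.measurableSet fun y _ => ?_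
    rw [hcontr, hcontr]
    simp only [hc]
    ring
  have hcK : ∀ y ∈ K, 0 < c v y := by
    rintro _ ⟨x, hx, rfl⟩
    exact (hf (hwsub hx)).2.2
  have hint : IntegrableOn (fun y => f (e.symm y) * c v y) K := by
    refine ContinuousOn.integrableOn_compact hKc (ContinuousOn.mul ?_ ((hcc v).mono L.subset))
    exact f.continuous.comp_continuousOn ((continuousOn_extChartAt_symm (I := 𝓡 2) x₀).mono
      (L.subset.trans inter_subset_left))
  have hae := (setIntegral_eq_zero_iff_of_nonneg_ae
    ((ae_restrict_iff' hKc.measurableSet).2 (Eventually.of_forall fun y hy =>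
      mul_nonneg f.nonneg (hcK y hy).le)) hint).1 hzero'
  rw [EventuallyEq, ae_restrict_iff' hKc.measurableSet] at hae
  have hv : v ≠ 0 := by
    rintro rfl
    simp [hc] at hpos
  -- A nonempty open subset of `K` on which the integrand is nonzero, although the vanishing of a
  -- nonnegative integral forces it to be zero almost everywhere.
  set W := e.target ∩ e.symm ⁻¹' {x | f x ≠ 0} with hWdef
  have hWo : IsOpen W := (continuousOn_extChartAt_symm (I := 𝓡 2) x₀).isOpen_inter_preimage
    (isOpen_extChartAt_target (I := 𝓡 2) x₀) (isOpen_ne_fun f.continuous continuous_const)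
  have hWne : W.Nonempty := ⟨e x₀, mem_extChartAt_target x₀, by
    rw [mem_preimage, mem_ofPred_eq, extChartAt_to_inv, f.eq_one]; exact one_ne_zero⟩
  have hWK : W ⊆ K := fun y hy => ⟨e.symm y, subset_tsupport w (smul_ne_zero hy.2 hv),
    e.right_inv hy.1⟩
  have hnull : (volume : Measure (EuclideanSpace ℝ (Fin 2))) W = 0 := by
    refine measure_mono_null (fun y hy => ?_) (ae_iff.1 hae)
    rw [mem_ofPred_eq]
    intro hy'
    exact mul_ne_zero hy.2 (hcK y (hWK hy)).ne' (hy' (hWK hy))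
  exact (hWo.measure_pos volume hWne).ne' hnull

/-- By nondegeneracy the Euler-Lagrange equation is the vector identity `L e₁ • a = L e₀ • b` with
`a`, `b` the partial derivatives of `φ`. Evaluating `B` on it against `b` and `a` leaves `L eᵢ * B a
b = 0`, and `B a b` is the coefficient up to the density. -/
theorem IsCriticalPoint.mul_fderiv_eq_zero (hφ : IsCriticalPoint (m := 2) Ω φ)
    (hO : IsOrientedPatch o x₀ O ε) (hx₀ : x₀ ∈ O) :
    (dens (formInChart Ω.toForm (φ x₀)) e₀ e₁ (inCharts x₀ (φ x₀) φ) (extChartAt (𝓡 2) x₀ x₀) /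
      density 2 x₀ ((extChartAt (𝓡 2) x₀).symm (extChartAt (𝓡 2) x₀ x₀))) •
    fderiv ℝ (fun y => dens (formInChart Ω.toForm (φ x₀)) e₀ e₁ (inCharts x₀ (φ x₀) φ) y /
        density 2 x₀ ((extChartAt (𝓡 2) x₀).symm y)) (extChartAt (𝓡 2) x₀ x₀) = 0 := by
  have hEL := eulerLagrange hφ hO hx₀
  set L := fderiv ℝ (fun y => dens (formInChart Ω.toForm (φ x₀)) e₀ e₁ (inCharts x₀ (φ x₀) φ) y /
        density 2 x₀ ((extChartAt (𝓡 2) x₀).symm y)) (extChartAt (𝓡 2) x₀ x₀) with hL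
  set B := formInChart Ω.toForm (φ x₀) (inCharts x₀ (φ x₀) φ (extChartAt (𝓡 2) x₀ x₀)) with hB
  set a := fderiv ℝ (inCharts (n := n) x₀ (φ x₀) φ) (extChartAt (𝓡 2) x₀ x₀) e₀ with ha
  set b := fderiv ℝ (inCharts (n := n) x₀ (φ x₀) φ) (extChartAt (𝓡 2) x₀ x₀) e₁ with hb
  have hu : inCharts x₀ (φ x₀) φ (extChartAt (𝓡 2) x₀ x₀) =
      extChartAt (𝓡 n) (φ x₀) (φ x₀) := by
    rw [inCharts, extChartAt_to_inv]
  have hz : L e₁ • a - L e₀ • b = 0 := by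
    refine formInChart_nondegenerate Ω (mem_extChartAt_source (I := 𝓡 n) (φ x₀)) fun v => ?_
    rw [← hu, ← hB, map_sub, map_smul, map_smul, smul_eq_mul, smul_eq_mul]
    exact hEL v
  have hsw : ∀ c d, B c d = -B d c := fun c d => toBilin_swap _ c d
  have haa : ∀ c, B c c = 0 := fun c => by linarith [hsw c c]
  have hd : dens (formInChart Ω.toForm (φ x₀)) e₀ e₁ (inCharts x₀ (φ x₀) φ)
      (extChartAt (𝓡 2) x₀ x₀) = B a b := rfl
  have h1 : L e₁ * B a b = 0 := by
    have := congrArg (fun z => B z b) hz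
    simpa [haa] using this
  have h0 : L e₀ * B a b = 0 := by
    have := congrArg (fun z => B a z) hz
    simpa [haa] using this
  rw [hd, div_eq_mul_inv]
  refine ContinuousLinearMap.coe_injective
    ((EuclideanSpace.basisFun (Fin 2) ℝ).toBasis.ext fun i => ?_)
  rw [OrthonormalBasis.coe_toBasis, EuclideanSpace.basisFun_apply]
  have e0 : L (EuclideanSpace.single 0 1) = 0 ∨ B a b = 0 := mul_eq_zero.1 h0
  have e1 : L (EuclideanSpace.single 1 1) = 0 ∨ B a b = 0 := mul_eq_zero.1 h1
  fin_cases i <;> simp <;> tauto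

/-- The square is used because its differential `2 k dk` is exactly what the previous equation
kills; squaring also removes the sign `ε`. -/
theorem IsCriticalPoint.isLocallyConstant (hφ : IsCriticalPoint (m := 2) Ω φ) :
    IsLocallyConstant (pullbackCoeff o Ω φ) := by
  have hk := contMDiff_pullbackCoeff o Ω hφ.1
  refine isLocallyConstant_of_sq hk.continuous
    (isLocallyConstant_of_hasMFDerivAt_zero (m := 2) fun x₀ => ?_)
  obtain ⟨O, ε, hx₀, h⟩ := exists_isOrientedPatch o x₀
  have hp : φ x₀ ∈ (extChartAt (𝓡 n) (φ x₀)).source := mem_extChartAt_source _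
  have hy : extChartAt (𝓡 2) x₀ x₀ ∈ chartDomain n x₀ (φ x₀) O φ := by
    refine ⟨mem_extChartAt_target x₀, ?_⟩
    rw [mem_preimage, extChartAt_to_inv]
    exact ⟨hx₀, hp⟩
  have hF := (((contDiffOn_coeff_inCharts (Ω := Ω) (x₀ := x₀) (p₀ := φ x₀) h.isOpen
    hφ.1).contDiffAt ((isOpen_chartDomain (n := n) h.isOpen
      hφ.1.continuous).mem_nhds hy)).differentiableAt (by simp)).hasFDerivAt.pow 2
  have hF' : HasFDerivAt (fun y => (dens (formInChart Ω.toForm (φ x₀)) e₀ e₁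
      (inCharts x₀ (φ x₀) φ) y / density 2 x₀ ((extChartAt (𝓡 2) x₀).symm y)) ^ 2)
      (0 : EuclideanSpace ℝ (Fin 2) →L[ℝ] ℝ) (extChartAt (𝓡 2) x₀ x₀) := by
    refine hF.congr_fderiv ?_
    have := hφ.mul_fderiv_eq_zero h hx₀
    ext v
    have := congrArg (fun T : EuclideanSpace ℝ (Fin 2) →L[ℝ] ℝ => T v) this
    simp at this ⊢
    tauto
  have h1 : HasMFDerivAt (𝓡 2) 𝓘(ℝ, EuclideanSpace ℝ (Fin 2)) (extChartAt (𝓡 2) x₀) x₀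
      (mfderiv (𝓡 2) 𝓘(ℝ, EuclideanSpace ℝ (Fin 2)) (extChartAt (𝓡 2) x₀) x₀) :=
    (mdifferentiableAt_extChartAt (mem_chart_source _ x₀)).hasMFDerivAt
  have h2 := (hasMFDerivAt_iff_hasFDerivAt.2 hF').comp x₀ h1
  have h3 : HasMFDerivAt (𝓡 2) 𝓘(ℝ, ℝ) _ x₀ (0 : EuclideanSpace ℝ (Fin 2) →L[ℝ] ℝ) :=
    h2.congr_mfderiv (ContinuousLinearMap.zero_comp _)
  refine h3.congr_of_eventuallyEq ?_
  filter_upwards [h.isOpen.mem_nhds hx₀, hφ.1.continuous.continuousAt.preimage_mem_nhds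
    ((isOpen_extChartAt_source (I := 𝓡 n) (φ x₀)).mem_nhds hp)] with x hx hpx
  rw [pullbackCoeff_eq h (hφ.1.mdifferentiableAt (by simp)) hx hpx]
  simp only [Function.comp_apply]
  rw [(extChartAt (𝓡 2) x₀).left_inv (h.subset hx), mul_pow, sq ε, h.sq_eq, one_mul]

end Critical

/-! ### Locally constant functions on dense subsets and the compact-open topology. -/

section Topology

/-- A function on a dense subset of a space which is locally constant near every point of the
space takes the same value at the end points of a path. -/
theorem eq_of_path_of_dense {Z α : Type*} [TopologicalSpace Z] {S : Set Z} (hS : Dense S)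
    {Q : Z → α}
    (hQ : ∀ z, ∀ᶠ p : Z × Z in 𝓝 (z, z), p.1 ∈ S → p.2 ∈ S → Q p.1 = Q p.2)
    {γ : unitInterval → Z} (hγ : Continuous γ) (h0 : γ 0 ∈ S) (h1 : γ 1 ∈ S) :
    Q (γ 0) = Q (γ 1) := by
  have hex : ∀ z, ∃ c, ∀ᶠ x in 𝓝 z, x ∈ S → Q x = c := fun z => by
    have hz := hQ z
    rw [nhds_prod_eq] at hz
    obtain ⟨U, hU, h⟩ :=
      eventually_prod_self_iff (r := fun a b => a ∈ S → b ∈ S → Q a = Q b) |>.1 hz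
    obtain ⟨s, hs, hsS⟩ := (mem_closure_iff_nhds.1 (hS z)) U hU
    exact ⟨Q s, mem_of_superset hU fun x hx hxS => h x hx s hs hxS hsS⟩
  choose c hc using hex
  have hSc : ∀ z ∈ S, c z = Q z := fun z hz => ((hc z).self_of_nhds hz).symm
  have hloc : IsLocallyConstant c := by
    rw [IsLocallyConstant.iff_eventually_eq]
    intro z
    filter_upwards [eventually_eventually_nhds.2 (hc z)] with y hy
    -- The local values at `z` and at a nearby `y` are compared at a point of `S` close to `y`,
    -- where both must equal `Q`.
    obtain ⟨s, hs, hsS⟩ := (mem_closure_iff_nhds.1 (hS y)) _ (hy.and (hc y))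
    rw [← hs.1 hsS, ← hs.2 hsS]
  rw [← hSc _ h0, ← hSc _ h1]
  exact (hloc.comp_continuous hγ).apply_eq_of_preconnectedSpace 0 1

variable {X Y T : Type*} [TopologicalSpace X] [TopologicalSpace Y] [TopologicalSpace T]

/-- Joint convergence at each point becomes uniform over compact sets, which is convergence in the
compact-open topology. Since `F t` need not be continuous, `g` serves as the default value. -/
theorem eventually_mem_nhds_of_tendsto {F : T → X → Y} {t₀ : T} {g : C(X, Y)}
    (hF : ∀ x, Tendsto (fun p : T × X => F p.1 p.2) (𝓝 (t₀, x)) (𝓝 (g x)))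
    {U : Set C(X, Y)} (hU : U ∈ 𝓝 g) :
    ∀ᶠ t in 𝓝 t₀, ∀ h : Continuous (F t), (⟨F t, h⟩ : C(X, Y)) ∈ U := by
  classical
  set R : T → C(X, Y) := fun t => if h : Continuous (F t) then ⟨F t, h⟩ else g with hR
  have hlim : Tendsto R (𝓝 t₀) (𝓝 g) := by
    rw [ContinuousMap.tendsto_nhds_compactOpen]
    intro K hK V hV hgV
    have h1 : ∀ᶠ t in 𝓝 t₀, ∀ x ∈ K, F t x ∈ V :=
      hK.eventually_forall_of_forall_eventually fun x hx =>
        (hF x).eventually (hV.mem_nhds (hgV hx))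
    filter_upwards [h1] with t ht x hx
    by_cases h : Continuous (F t)
    · simpa [hR, h] using ht x hx
    · simpa [hR, h] using hgV hx
  filter_upwards [hlim.eventually hU] with t ht h
  have : R t = ⟨F t, h⟩ := dif_pos h
  exact this ▸ ht

end Topology

/-! ### Stability of chart moves near a continuous map. -/

section PatchFamily

variable {n : ℕ} {N X S : Type*} [TopologicalSpace N] [ChartedSpace (EuclideanSpace ℝ (Fin n)) N]
  [TopologicalSpace X] [CompactSpace X] [T2Space X] [TopologicalSpace S]
  {p₀ : N} {g : C(X, N)} {s₀ : S} {η : X → ℝ} {W : C(X, N) × S → X → EuclideanSpace ℝ (Fin n)}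

theorem tendsto_extChartAt_comp {x : X} (hx : g x ∈ (extChartAt (𝓡 n) p₀).source) :
    Tendsto (fun p : (C(X, N) × S) × X => extChartAt (𝓡 n) p₀ (p.1.1 p.2)) (𝓝 ((g, s₀), x))
      (𝓝 (extChartAt (𝓡 n) p₀ (g x))) := by
  have h1 : Continuous fun p : (C(X, N) × S) × X => p.1.1 p.2 := by fun_prop
  have h2 : ContinuousAt (extChartAt (𝓡 n) p₀) (g x) := continuousAt_extChartAt' hx
  exact h2.tendsto.comp (h1.tendsto ((g, s₀), x))

theorem eventually_map_mem_source (hg : ∀ x ∈ tsupport η, g x ∈ (extChartAt (𝓡 n) p₀).source) :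
    ∀ᶠ t : C(X, N) × S in 𝓝 (g, s₀), ∀ x ∈ tsupport η, t.1 x ∈ (extChartAt (𝓡 n) p₀).source := by
  have h1 : Continuous fun p : (C(X, N) × S) × X => p.1.1 p.2 := by fun_prop
  exact (isClosed_tsupport η).isCompact.eventually_forall_of_forall_eventually fun x hx =>
    (h1.tendsto ((g, s₀), x)).eventually
      ((isOpen_extChartAt_source (I := 𝓡 n) p₀).mem_nhds (hg x hx))

/-- At the limit the increment is zero, and compactness of `tsupport η ×ˢ Icc (-2) 2` makes the
openness of the target uniform. The interval exceeds `[0, 1]` to leave the margin required of a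
variation. -/
theorem eventually_mem_target (hη : Continuous η)
    (hg : ∀ x ∈ tsupport η, g x ∈ (extChartAt (𝓡 n) p₀).source)
    (hW : ∀ x ∈ tsupport η, Tendsto (fun p : (C(X, N) × S) × X => W p.1 p.2) (𝓝 ((g, s₀), x))
      (𝓝 0)) :
    ∀ᶠ t : C(X, N) × S in 𝓝 (g, s₀), ∀ x ∈ tsupport η, ∀ s ∈ Icc (-2 : ℝ) 2,
      extChartAt (𝓡 n) p₀ (t.1 x) + s • (η x • W t x) ∈ (extChartAt (𝓡 n) p₀).target := by
  have h : ∀ᶠ t : C(X, N) × S in 𝓝 (g, s₀), ∀ q ∈ tsupport η ×ˢ Icc (-2 : ℝ) 2,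
      extChartAt (𝓡 n) p₀ (t.1 q.1) + q.2 • (η q.1 • W t q.1) ∈ (extChartAt (𝓡 n) p₀).target := by
    refine ((isClosed_tsupport η).isCompact.prod
      isCompact_Icc).eventually_forall_of_forall_eventually ?_
    rintro ⟨x, s⟩ ⟨hx, -⟩
    have hpr : Tendsto (fun p : (C(X, N) × S) × (X × ℝ) => (p.1, p.2.1)) (𝓝 ((g, s₀), (x, s)))
        (𝓝 ((g, s₀), x)) := Continuous.tendsto (by fun_prop) _
    have hlim : Tendsto (fun p : (C(X, N) × S) × (X × ℝ) =>
        extChartAt (𝓡 n) p₀ (p.1.1 p.2.1) + p.2.2 • (η p.2.1 • W p.1 p.2.1))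
        (𝓝 ((g, s₀), (x, s))) (𝓝 (extChartAt (𝓡 n) p₀ (g x) + s • (η x • 0))) := by
      refine ((tendsto_extChartAt_comp (hg x hx)).comp hpr).add (Tendsto.smul ?_
        (Tendsto.smul ?_ ((hW x hx).comp hpr)))
      · exact Continuous.tendsto (x := ((g, s₀), (x, s))) (by fun_prop)
      · exact Continuous.tendsto (x := ((g, s₀), (x, s)))
          (f := fun p : (C(X, N) × S) × (X × ℝ) => η p.2.1) (by fun_prop)
    rw [smul_zero, smul_zero, add_zero] at hlim
    exact hlim.eventually ((isOpen_extChartAt_target (I := 𝓡 n) p₀).mem_nhds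
      ((extChartAt (𝓡 n) p₀).map_source (hg x hx)))
  filter_upwards [h] with t ht x hx s hs using ht (x, s) ⟨hx, hs⟩

theorem eventually_patch_mem (hη : Continuous η)
    (hg : ∀ x ∈ tsupport η, g x ∈ (extChartAt (𝓡 n) p₀).source)
    (hW : ∀ x ∈ tsupport η, Tendsto (fun p : (C(X, N) × S) × X => W p.1 p.2) (𝓝 ((g, s₀), x))
      (𝓝 0)) {U : Set C(X, N)} (hU : U ∈ 𝓝 g) :
    ∀ᶠ t : C(X, N) × S in 𝓝 (g, s₀), ∀ h : Continuous (patch p₀ t.1 fun x => η x • W t x),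
      (⟨_, h⟩ : C(X, N)) ∈ U := by
  refine eventually_mem_nhds_of_tendsto
    (F := fun t : C(X, N) × S => patch p₀ t.1 fun x => η x • W t x) (fun x => ?_) hU
  have h1 : Continuous fun p : (C(X, N) × S) × X => p.1.1 p.2 := by fun_prop
  by_cases hx : x ∈ tsupport η
  · have h2 : Tendsto (fun p : (C(X, N) × S) × X =>
        extChartAt (𝓡 n) p₀ (p.1.1 p.2) + η p.2 • W p.1 p.2)
        (𝓝 ((g, s₀), x)) (𝓝 (extChartAt (𝓡 n) p₀ (g x) + η x • 0)) :=
      (tendsto_extChartAt_comp (hg x hx)).add (Tendsto.smul (Continuous.tendsto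
        (f := fun p : (C(X, N) × S) × X => η p.2) (by fun_prop) ((g, s₀), x)) (hW x hx))
    rw [smul_zero, add_zero] at h2
    have h3 : ContinuousAt (extChartAt (𝓡 n) p₀).symm (extChartAt (𝓡 n) p₀ (g x)) :=
      continuousAt_extChartAt_symm' (hg x hx)
    have h4 := h3.tendsto.comp h2
    rw [(extChartAt (𝓡 n) p₀).left_inv (hg x hx)] at h4
    refine h4.congr' ?_
    filter_upwards [(h1.tendsto ((g, s₀), x)).eventually
      ((isOpen_extChartAt_source (I := 𝓡 n) p₀).mem_nhds (hg x hx))] with p hp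
    exact (patch_of_mem (w := fun x => η x • W p.1 x) hp).symm
  · refine (h1.tendsto ((g, s₀), x)).congr' ?_
    have h2 : Tendsto (fun p : (C(X, N) × S) × X => p.2) (𝓝 ((g, s₀), x)) (𝓝 x) :=
      continuous_snd.tendsto _
    filter_upwards [h2.eventually (notMem_tsupport_iff_eventuallyEq.1 hx)] with p hp
    refine (patch_of_eq_zero ?_).symm
    rw [hp, Pi.zero_apply, zero_smul]

end PatchFamily

/-! ### Density of smooth maps. -/

section SmoothApproximation

variable {m n : ℕ} {M N : Type*}
  [TopologicalSpace M] [ChartedSpace (EuclideanSpace ℝ (Fin m)) M]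
  [TopologicalSpace N] [ChartedSpace (EuclideanSpace ℝ (Fin n)) N]
  {p₀ : N} {g : C(M, N)} {η : M → ℝ}

theorem tsupport_smul_field_subset {X F : Type*} [TopologicalSpace X] [NormedAddCommGroup F]
    [NormedSpace ℝ F] (η : X → ℝ) (w : X → F) : tsupport (fun x => η x • w x) ⊆ tsupport η :=
  closure_mono fun x hx h0 => hx (by simp [h0])

theorem contMDiff_smul_of_tsupport {F : Type*} [NormedAddCommGroup F] [NormedSpace ℝ F] {k : ℕ∞ω}
    {η : M → ℝ} {w : M → F} (hη : ContMDiff (𝓡 m) 𝓘(ℝ, ℝ) k η)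
    (hw : ∀ x ∈ tsupport η, ContMDiffAt (𝓡 m) 𝓘(ℝ, F) k w x) :
    ContMDiff (𝓡 m) 𝓘(ℝ, F) k fun x => η x • w x :=
  contMDiff_of_tsupport fun x hx => (hη x).smul (hw x (tsupport_smul_field_subset η w hx))

variable [IsManifold (𝓡 n) ∞ N] [CompactSpace M] [T2Space M]

omit [IsManifold (𝓡 n) ∞ N] in
theorem exists_continuousMap_eqOn_chart
    (hg : ∀ x ∈ tsupport η, g x ∈ (extChartAt (𝓡 n) p₀).source) :
    ∃ v : C(M, EuclideanSpace ℝ (Fin n)), ∀ x ∈ tsupport η, v x = extChartAt (𝓡 n) p₀ (g x) := by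
  have hc : ContinuousOn (fun x => extChartAt (𝓡 n) p₀ (g x)) (tsupport η) :=
    (continuousOn_extChartAt (I := 𝓡 n) p₀).comp g.continuous.continuousOn hg
  have : TietzeExtension (EuclideanSpace ℝ (Fin n)) := TietzeExtension.of_tvs ℝ
  obtain ⟨v, hv⟩ := ContinuousMap.exists_restrict_eq (isClosed_tsupport η)
    (⟨_, hc.domRestrict⟩ : C(tsupport η, EuclideanSpace ℝ (Fin n)))
  exact ⟨v, fun x hx => congrArg (fun f : C(tsupport η, EuclideanSpace ℝ (Fin n)) => f ⟨x, hx⟩) hv⟩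

/-- In the chart, `R` is interpolated by `η` towards a smooth vector-valued map `v` close to `g`.
Where `η = 1` the result is read off from `v` alone, hence smooth; wherever `R` was already smooth,
the interpolation keeps it so. -/
theorem eventually_exists_contMDiffAt (hη : ContMDiff (𝓡 m) 𝓘(ℝ, ℝ) ∞ η) [IsManifold (𝓡 m) ∞ M]
    (hg : ∀ x ∈ tsupport η, g x ∈ (extChartAt (𝓡 n) p₀).source) {U : Set C(M, N)} (hU : U ∈ 𝓝 g) :
    ∀ᶠ R : C(M, N) in 𝓝 g, ∃ R' ∈ U, ∀ x, ContMDiffAt (𝓡 m) (𝓡 n) ∞ R x ∨ η =ᶠ[𝓝 x] 1 →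
      ContMDiffAt (𝓡 m) (𝓡 n) ∞ R' x := by
  obtain ⟨v₀, hv₀⟩ := exists_continuousMap_eqOn_chart hg
  set W : C(M, N) × C(M, EuclideanSpace ℝ (Fin n)) → M → EuclideanSpace ℝ (Fin n) :=
    fun t x => t.2 x - extChartAt (𝓡 n) p₀ (t.1 x) with hWdef
  have hW : ∀ x ∈ tsupport η, Tendsto (fun p : (C(M, N) × C(M, EuclideanSpace ℝ (Fin n))) × M =>
      W p.1 p.2) (𝓝 ((g, v₀), x)) (𝓝 0) := fun x hx => by
    have h1 : Continuous fun p : (C(M, N) × C(M, EuclideanSpace ℝ (Fin n))) × M => p.1.2 p.2 := by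
      fun_prop
    have h2 := (h1.tendsto ((g, v₀), x)).sub (tendsto_extChartAt_comp (s₀ := v₀) (hg x hx))
    simp only [hv₀ x hx, sub_self] at h2
    exact h2
  have hA := (eventually_map_mem_source (s₀ := v₀) hg).and
    ((eventually_mem_target hη.continuous hg hW).and
      (eventually_patch_mem hη.continuous hg hW hU))
  rw [nhds_prod_eq] at hA
  obtain ⟨P, hP, Pv, hPv, hPP⟩ := eventually_prod_iff.1 hA
  obtain ⟨v, hvs, hv⟩ : ∃ v : C(M, EuclideanSpace ℝ (Fin n)),
      ContMDiff (𝓡 m) 𝓘(ℝ, EuclideanSpace ℝ (Fin n)) ∞ v ∧ Pv v := by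
    obtain ⟨r, hr, hball⟩ := Metric.eventually_nhds_iff.1 hPv
    have := ChartedSpace.secondCountable_of_sigmaCompact (EuclideanSpace ℝ (Fin m)) M
    obtain ⟨f, hf, -⟩ := v₀.continuous.exists_contMDiff_approx (𝓡 m) ⊤
      (continuous_const (y := r)) fun _ => hr
    exact ⟨⟨f, f.contMDiff.continuous⟩, f.contMDiff,
      hball ((ContinuousMap.dist_lt_iff hr).2 fun x => hf x)⟩
  filter_upwards [hP] with R hR
  obtain ⟨hsrc, htgt, hmem⟩ := hPP hR hv
  have ht : ∀ x ∈ tsupport η, extChartAt (𝓡 n) p₀ (R x) + η x • W (R, v) x ∈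
      (extChartAt (𝓡 n) p₀).target := fun x hx => by
    simpa using htgt x hx 1 (by norm_num)
  -- Stated for all orders: `k = 0` gives continuity of the new map, `k = ∞` its smoothness.
  have hcw : ∀ (k : ℕ∞ω) (x : M), k ≤ (∞ : ℕ∞ω) → x ∈ tsupport η → ContMDiffAt (𝓡 m) (𝓡 n) k R x →
      ContMDiffAt (𝓡 m) 𝓘(ℝ, EuclideanSpace ℝ (Fin n)) k (W (R, v)) x := fun k x hk hx hRx => by
    have : IsManifold (𝓡 n) k N := .of_le hk
    refine (hvs.contMDiffAt.of_le hk).sub ?_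
    exact ContMDiffAt.comp x (g := extChartAt (𝓡 n) p₀)
      (contMDiffAt_extChartAt' (by simpa using hsrc x hx)) hRx
  have hR0 : ContMDiff (𝓡 m) (𝓡 n) 0 R := contMDiff_zero_iff.2 R.continuous
  have hsub := tsupport_smul_field_subset η (W (R, v))
  have hcont : Continuous (patch p₀ R fun x => η x • W (R, v) x) := by
    refine ContMDiff.continuous (I := 𝓡 m) (I' := 𝓡 n) (n := 0) (contMDiff_patch hR0
      (contMDiff_smul_of_tsupport (hη.of_le (by simp)) fun x hx => hcw 0 x (by simp) hx (hR0 x))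
      (fun x hx => hsrc x (hsub hx)) fun x hx => ht x (hsub hx))
  refine ⟨⟨_, hcont⟩, hmem hcont, fun x hx => ?_⟩
  change ContMDiffAt (𝓡 m) (𝓡 n) ∞ (patch p₀ R fun x => η x • W (R, v) x) x
  rcases hx with hx | hx
  · by_cases hxη : x ∈ tsupport η
    · exact contMDiffAt_patch hx ((hη x).smul (hcw (∞ : ℕ∞ω) x le_rfl hxη hx)) (hsrc x hxη)
        (ht x hxη)
    · exact hx.congr_of_eventuallyEq (patch_eventuallyEq fun h => hxη (hsub h))
  · have hxη : x ∈ tsupport η := subset_tsupport η (by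
      rw [Function.mem_support, hx.self_of_nhds, Pi.one_apply]; exact one_ne_zero)
    have hvt : v x ∈ (extChartAt (𝓡 n) p₀).target := by
      have := ht x hxη
      rwa [hx.self_of_nhds, Pi.one_apply, one_smul, hWdef, add_sub_cancel] at this
    have h2 : ContMDiffAt 𝓘(ℝ, EuclideanSpace ℝ (Fin n)) (𝓡 n) ∞ (extChartAt (𝓡 n) p₀).symm (v x) :=
      (contMDiffOn_extChartAt_symm p₀).contMDiffAt
        ((isOpen_extChartAt_target (I := 𝓡 n) p₀).mem_nhds hvt)
    refine (h2.comp x (hvs x)).congr_of_eventuallyEq ?_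
    filter_upwards [hx] with z hz
    have hzη : z ∈ tsupport η := subset_tsupport η (by
      rw [Function.mem_support, hz, Pi.one_apply]; exact one_ne_zero)
    rw [patch_of_mem (hsrc z hzη), hz, Pi.one_apply, one_smul, hWdef, add_sub_cancel]
    rfl

/-- Smooth maps are dense in the space of continuous maps from a compact manifold. -/
theorem dense_contMDiff [IsManifold (𝓡 m) ∞ M] :
    Dense {f : C(M, N) | ContMDiff (𝓡 m) (𝓡 n) ∞ f} := fun g => by
  have hb : ∀ x : M, ∃ η : SmoothBumpFunction (𝓡 m) x,
      tsupport η ⊆ g ⁻¹' (extChartAt (𝓡 n) (g x)).source := fun x => by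
    obtain ⟨η, -, hη⟩ := (SmoothBumpFunction.nhds_basis_tsupport (I := 𝓡 m) x).mem_iff.1
      (g.continuous.continuousAt.preimage_mem_nhds
        (extChartAt_source_mem_nhds (I := 𝓡 n) (g x)))
    exact ⟨η, hη⟩
  choose η hη using hb
  have hstep : ∀ s : Finset M, ∀ U ∈ 𝓝 g, ∃ R ∈ U, ∀ x, (∃ i ∈ s, η i =ᶠ[𝓝 x] 1) →
      ContMDiffAt (𝓡 m) (𝓡 n) ∞ R x := by
    classical
    intro s
    induction s using Finset.induction_on with
    | empty => exact fun U hU => ⟨g, mem_of_mem_nhds hU, by simp⟩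
    | insert i s _ ih =>
      intro U hU
      -- The induction hypothesis is applied to the neighbourhood of maps from which one further
      -- step still lands in `U`.
      obtain ⟨R, ⟨R', hR'U, hR'⟩, hR⟩ := ih _ (eventually_exists_contMDiffAt
        (η i).contMDiff (hη i) hU)
      refine ⟨R', hR'U, ?_⟩
      rintro x ⟨j, hj, hjx⟩
      rcases Finset.mem_insert.1 hj with rfl | hj
      · exact hR' x (.inr hjx)
      · exact hR' x (.inl (hR x ⟨j, hj, hjx⟩))
  -- Smoothness at a point depends on the germ, so the bump must equal 1 near `z`, not just at `z`.
  obtain ⟨s, -, hs⟩ := isCompact_univ.elim_nhds_subcover (fun x => {z | η x =ᶠ[𝓝 z] 1})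
    fun x _ => eventually_eventually_nhds.2 (η x).eventuallyEq_one
  refine mem_closure_iff_nhds.2 fun U hU => ?_
  obtain ⟨R, hRU, hR⟩ := hstep s U hU
  refine ⟨R, hRU, fun x => hR x ?_⟩
  simpa using hs (mem_univ x)

end SmoothApproximation

/-! ### Homotopy invariance of weighted integrals, and minimality. -/

section HomotopyInvariance

variable {n : ℕ} {M N : Type*}
  [TopologicalSpace M] [ChartedSpace (EuclideanSpace ℝ (Fin 2)) M] [IsManifold (𝓡 2) ∞ M]
  [TopologicalSpace N] [ChartedSpace (EuclideanSpace ℝ (Fin n)) N] [IsManifold (𝓡 n) ∞ N]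
  [RiemannianBundle (fun x : M => TangentSpace (𝓡 2) x)]
  [IsContMDiffRiemannianBundle (𝓡 2) ∞ (EuclideanSpace ℝ (Fin 2))
      (fun x : M => TangentSpace (𝓡 2) x)]
  [CompactSpace M] [T2Space M] [MeasurableSpace M] [BorelSpace M]
  {o : ManifoldOrientation 2 M} {Ω : SymplecticForm n N} {f : M → ℝ}

/-- One chart move with field `η` times the coordinate difference `W`. It reaches `t.2` where `η =
1`, and since `W` vanishes where the two maps agree, it does not undo agreement from earlier moves.
-/
theorem eventually_exists_integral_eq (Ω : SymplecticForm n N) (hf : IsLocallyConstant f)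
    {x₀ : M} {p₀ : N} {O : Set M} {ε : ℝ} {g : C(M, N)} {η : M → ℝ}
    (hO : IsOrientedPatch o x₀ O ε)
    (hη : ContMDiff (𝓡 2) 𝓘(ℝ, ℝ) ∞ η) (hηO : tsupport η ⊆ O)
    (hg : ∀ x ∈ tsupport η, g x ∈ (extChartAt (𝓡 n) p₀).source) {U : Set C(M, N)} (hU : U ∈ 𝓝 g) :
    ∀ᶠ t : C(M, N) × C(M, N) in 𝓝 (g, g), ContMDiff (𝓡 2) (𝓡 n) ∞ t.1 →
      ContMDiff (𝓡 2) (𝓡 n) ∞ t.2 → ∃ R ∈ U, ContMDiff (𝓡 2) (𝓡 n) ∞ R ∧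
        ∫ x, f x * pullbackCoeff o Ω R x ∂(riemannianVolume 2 M) =
          ∫ x, f x * pullbackCoeff o Ω t.1 x ∂(riemannianVolume 2 M) ∧
        ∀ x, η x = 1 ∨ t.1 x = t.2 x → R x = t.2 x := by
  set W : C(M, N) × C(M, N) → M → EuclideanSpace ℝ (Fin n) :=
    fun t x => extChartAt (𝓡 n) p₀ (t.2 x) - extChartAt (𝓡 n) p₀ (t.1 x) with hWdef
  have hW : ∀ x ∈ tsupport η, Tendsto (fun p : (C(M, N) × C(M, N)) × M => W p.1 p.2)
      (𝓝 ((g, g), x)) (𝓝 0) := fun x hx => by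
    have hsw : Tendsto (fun p : (C(M, N) × C(M, N)) × M => (p.1.swap, p.2)) (𝓝 ((g, g), x))
      (𝓝 ((g, g), x)) := Continuous.tendsto (by fun_prop) ((g, g), x)
    have h2 := ((tendsto_extChartAt_comp (s₀ := g) (hg x hx)).comp hsw).sub
      (tendsto_extChartAt_comp (s₀ := g) (hg x hx))
    rw [sub_self] at h2
    exact h2
  have hsrc := eventually_map_mem_source (s₀ := g) hg
  filter_upwards [hsrc, (continuous_swap.tendsto (g, g)).eventually hsrc,
    eventually_mem_target hη.continuous hg hW, eventually_patch_mem hη.continuous hg hW hU]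
    with t h1 h2 h3 h4 hs1 hs2
  have hsub := tsupport_smul_field_subset η (W t)
  have hvar : PatchVariation o t.1 (fun x => η x • W t x) x₀ p₀ O ε 2 :=
    { isOrientedPatch := hO
      contMDiff := hs1
      contMDiff_field := contMDiff_smul_of_tsupport hη fun x hx => by
        have a1 : ContMDiffAt (𝓡 2) 𝓘(ℝ, EuclideanSpace ℝ (Fin n)) ∞
            (fun x => extChartAt (𝓡 n) p₀ (t.2 x)) x :=
          ContMDiffAt.comp x (g := extChartAt (𝓡 n) p₀)
            (contMDiffAt_extChartAt' (by simpa using h2 x hx)) (hs2 x)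
        have a2 : ContMDiffAt (𝓡 2) 𝓘(ℝ, EuclideanSpace ℝ (Fin n)) ∞
            (fun x => extChartAt (𝓡 n) p₀ (t.1 x)) x :=
          ContMDiffAt.comp x (g := extChartAt (𝓡 n) p₀)
            (contMDiffAt_extChartAt' (by simpa using h1 x hx)) (hs1 x)
        exact a1.sub a2
      tsupport_subset := hsub.trans hηO
      map_mem := fun x hx => h1 x (hsub hx)
      mem_target := fun x hx s hs => h3 x (hsub hx) s (Ioo_subset_Icc_self hs) }
  have hsm : ContMDiff (𝓡 2) (𝓡 n) ∞ (patch p₀ t.1 fun x => η x • W t x) := by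
    have := hvar.contMDiff_patch (s := 1) (by constructor <;> norm_num)
    rwa [one_smul] at this
  refine ⟨⟨_, hsm.continuous⟩, h4 _, hsm,
    hvar.integral_mul_pullbackCoeff_patch_eq one_lt_two Ω hf, fun x hx => ?_⟩
  change patch p₀ t.1 (fun x => η x • W t x) x = t.2 x
  rcases hx with hx | hx
  · have hxη : x ∈ tsupport η :=
      subset_tsupport η (by rw [Function.mem_support, hx]; exact one_ne_zero)
    rw [patch_of_mem (h1 x hxη), hx, one_smul, hWdef, add_sub_cancel]
    exact (extChartAt (𝓡 n) p₀).left_inv (h2 x hxη)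
  · rw [patch_of_eq_zero, hx]
    simp [hWdef, hx]

/-- The sets `{η x = 1}` of finitely many bumps cover `M`; one move for each transforms `t.1` into
`t.2`. Every intermediate map must stay close enough to `g` for the next move, which is why the
induction carries an arbitrary neighbourhood `U`. -/
theorem eventually_integral_eq (o : ManifoldOrientation 2 M) (Ω : SymplecticForm n N)
    (hf : IsLocallyConstant f) (g : C(M, N)) :
    ∀ᶠ t : C(M, N) × C(M, N) in 𝓝 (g, g), ContMDiff (𝓡 2) (𝓡 n) ∞ t.1 →
      ContMDiff (𝓡 2) (𝓡 n) ∞ t.2 →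
        ∫ x, f x * pullbackCoeff o Ω t.1 x ∂(riemannianVolume 2 M) =
          ∫ x, f x * pullbackCoeff o Ω t.2 x ∂(riemannianVolume 2 M) := by
  have hb : ∀ x : M, ∃ (η : SmoothBumpFunction (𝓡 2) x) (O : Set M) (ε : ℝ),
      IsOrientedPatch o x O ε ∧ tsupport η ⊆ O ∧
      tsupport η ⊆ g ⁻¹' (extChartAt (𝓡 n) (g x)).source := fun x => by
    obtain ⟨O, ε, hx, hO⟩ := exists_isOrientedPatch o x
    obtain ⟨η, -, hη⟩ := (SmoothBumpFunction.nhds_basis_tsupport (I := 𝓡 2) x).mem_iff.1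
      (inter_mem (hO.isOpen.mem_nhds hx) (g.continuous.continuousAt.preimage_mem_nhds
        (extChartAt_source_mem_nhds (I := 𝓡 n) (g x))))
    exact ⟨η, O, ε, hO, hη.trans inter_subset_left, hη.trans inter_subset_right⟩
  choose η O ε hO hηO hη using hb
  have hstep : ∀ s : Finset M, ∀ U ∈ 𝓝 g, ∀ᶠ t : C(M, N) × C(M, N) in 𝓝 (g, g),
      ContMDiff (𝓡 2) (𝓡 n) ∞ t.1 → ContMDiff (𝓡 2) (𝓡 n) ∞ t.2 →
      ∃ R ∈ U, ContMDiff (𝓡 2) (𝓡 n) ∞ R ∧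
        ∫ x, f x * pullbackCoeff o Ω R x ∂(riemannianVolume 2 M) =
          ∫ x, f x * pullbackCoeff o Ω t.1 x ∂(riemannianVolume 2 M) ∧
        ∀ x, (∃ i ∈ s, η i x = 1) → R x = t.2 x := by
    classical
    intro s
    induction s using Finset.induction_on with
    | empty =>
      intro U hU
      filter_upwards [(continuous_fst.tendsto (g, g)).eventually hU] with t ht h1 _
      exact ⟨t.1, ht, h1, rfl, by simp⟩
    | insert i s _ ih =>
      intro U hU
      have h := eventually_exists_integral_eq Ω hf (hO i) (η i).contMDiff (hηO i) (hη i) hU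
      rw [nhds_prod_eq] at h
      obtain ⟨P, hP, P', hP', hPP⟩ := eventually_prod_iff.1 h
      filter_upwards [ih _ hP, (continuous_snd.tendsto (g, g)).eventually hP'] with t h1 h2 hs1 hs2
      obtain ⟨R, hRP, hR, hRint, hReq⟩ := h1 hs1 hs2
      obtain ⟨R', hR'U, hR', hR'int, hR'eq⟩ := hPP hRP h2 hR hs2
      refine ⟨R', hR'U, hR', hR'int.trans hRint, ?_⟩
      rintro x ⟨j, hj, hjx⟩
      rcases Finset.mem_insert.1 hj with rfl | hj
      · exact hR'eq x (.inl hjx)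
      · exact hR'eq x (.inr (hReq x ⟨j, hj, hjx⟩))
  obtain ⟨s, -, hs⟩ := isCompact_univ.elim_nhds_subcover (fun x => {z | η x z = 1})
    fun x _ => (η x).eventuallyEq_one
  filter_upwards [hstep s univ univ_mem] with t ht h1 h2
  obtain ⟨R, -, -, hRint, hReq⟩ := ht h1 h2
  have hRt : R = t.2 := by
    ext x
    exact hReq x (by simpa using hs (mem_univ x))
  rw [← hRint, hRt]

/-- For a locally constant weight `f`, the integral of `f φ^*Ω` depends only on the homotopy class
of the smooth map `φ`. -/
theorem integral_eq_of_homotopic (o : ManifoldOrientation 2 M) (Ω : SymplecticForm n N)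
    (hf : IsLocallyConstant f) {φ ψ : C(M, N)} (hφ : ContMDiff (𝓡 2) (𝓡 n) ∞ φ)
    (hψ : ContMDiff (𝓡 2) (𝓡 n) ∞ ψ) (h : ContinuousMap.Homotopic φ ψ) :
    ∫ x, f x * pullbackCoeff o Ω φ x ∂(riemannianVolume 2 M) =
      ∫ x, f x * pullbackCoeff o Ω ψ x ∂(riemannianVolume 2 M) := by
  obtain ⟨H⟩ := h
  have h0 : H.curry 0 = φ := by ext x; simp
  have h1 : H.curry 1 = ψ := by ext x; simp
  have key := eq_of_path_of_dense (dense_contMDiff (m := 2) (n := n) (M := M) (N := N))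
    (Q := fun φ : C(M, N) => ∫ x, f x * pullbackCoeff o Ω φ x ∂(riemannianVolume 2 M))
    (fun g => eventually_integral_eq o Ω hf g) H.curry.continuous
    (by rw [h0]; exact hφ) (by rw [h1]; exact hψ)
  rwa [h0, h1] at key

/-- Integrate `2 k_φ k_ψ - k_φ² ≤ k_ψ²`; homotopy invariance with the locally constant weight `k_φ`
turns the left side into `∫ k_φ²`. -/
theorem IsCriticalPoint.energy_le (o : ManifoldOrientation 2 M) {φ ψ : C(M, N)}
    (hφ : IsCriticalPoint (m := 2) Ω φ) (hψ : ContMDiff (𝓡 2) (𝓡 n) ∞ ψ)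
    (h : ContinuousMap.Homotopic φ ψ) : energy (m := 2) Ω φ ≤ energy (m := 2) Ω ψ := by
  have hkφ := (contMDiff_pullbackCoeff o Ω hφ.1).continuous
  have hkψ := (contMDiff_pullbackCoeff o Ω hψ).continuous
  have heq := integral_eq_of_homotopic o Ω (hφ.isLocallyConstant (o := o)) hφ.1 hψ h
  have hi1 : Integrable (fun x => 2 * (pullbackCoeff o Ω φ x * pullbackCoeff o Ω ψ x))
      (riemannianVolume 2 M) := integrable_riemannianVolume ((hkφ.mul hkψ).const_mul 2)
  have hi2 : Integrable (fun x => pullbackCoeff o Ω φ x ^ 2) (riemannianVolume 2 M) :=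
    integrable_riemannianVolume (hkφ.pow 2)
  have hle : ∫ x, (2 * (pullbackCoeff o Ω φ x * pullbackCoeff o Ω ψ x) -
      pullbackCoeff o Ω φ x ^ 2) ∂(riemannianVolume 2 M) ≤
      ∫ x, pullbackCoeff o Ω ψ x ^ 2 ∂(riemannianVolume 2 M) := by
    refine integral_mono (hi1.sub hi2) (integrable_riemannianVolume (hkψ.pow 2)) fun x => ?_
    have := sq_nonneg (pullbackCoeff o Ω φ x - pullbackCoeff o Ω ψ x)
    simp only
    linarith
  rw [integral_sub hi1 hi2, integral_const_mul, ← heq] at hle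
  simp only [← sq] at hle
  rw [energy_eq Ω o, energy_eq Ω o]
  linarith

end HomotopyInvariance

end SymplecticEnergy

end

/-! ### The theorem, from local constancy of the coefficient and the energy inequality. -/

theorem mainTheorem3 {n : ℕ} {M N : Type*}
    [TopologicalSpace M] [T2Space M] [CompactSpace M]
    [ChartedSpace (EuclideanSpace ℝ (Fin 2)) M] [IsManifold (𝓡 2) ∞ M]
    [MeasurableSpace M] [BorelSpace M]
    [RiemannianBundle (fun x : M => TangentSpace (𝓡 2) x)]
    [IsContMDiffRiemannianBundle (𝓡 2) ∞ (EuclideanSpace ℝ (Fin 2))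
      (fun x : M => TangentSpace (𝓡 2) x)]
    [TopologicalSpace N] [T2Space N] [SecondCountableTopology N]
    [ChartedSpace (EuclideanSpace ℝ (Fin n)) N] [IsManifold (𝓡 n) ∞ N]
    (o : SymplecticEnergy.ManifoldOrientation 2 M)
    (Ω : SymplecticEnergy.SymplecticForm n N)
    (φ : C(M, N)) (hφ : SymplecticEnergy.IsCriticalPoint (m := 2) Ω φ) :
    SymplecticEnergy.IsCoclosed o (SymplecticEnergy.pullback φ Ω.toForm) ∧
    (∃ f : M → ℝ, ContMDiff (𝓡 2) 𝓘(ℝ, ℝ) ∞ f ∧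
      (∀ x, (SymplecticEnergy.pullback (m := 2) φ Ω.toForm x).toAlternatingMap =
        f x • (o.at' x).volumeForm) ∧
      (∀ x, f x * ‖SymplecticEnergy.gradient (m := 2) f x‖ ^ 2 = 0) ∧
      IsLocallyConstant f ∧
      (ConnectedSpace M → ∃ c : ℝ, ∀ x, f x = c)) ∧
    (∀ ψ : C(M, N), ContMDiff (𝓡 2) (𝓡 n) ∞ ψ → ContinuousMap.Homotopic φ ψ →
      SymplecticEnergy.energy (m := 2) Ω φ ≤ SymplecticEnergy.energy (m := 2) Ω ψ) := by
  have hloc : IsLocallyConstant (SymplecticEnergy.pullbackCoeff o Ω φ) := hφ.isLocallyConstant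
  have hd : ∀ x, mfderiv (𝓡 2) 𝓘(ℝ, ℝ) (SymplecticEnergy.pullbackCoeff o Ω φ) x = 0 := fun x => by
    have h : SymplecticEnergy.pullbackCoeff o Ω φ =ᶠ[𝓝 x]
      fun _ => SymplecticEnergy.pullbackCoeff o Ω φ x :=
      (IsLocallyConstant.iff_eventually_eq _).1 hloc x
    exact h.mfderiv_eq.trans mfderiv_const
  refine ⟨fun x => ?_, ⟨SymplecticEnergy.pullbackCoeff o Ω φ,
    SymplecticEnergy.contMDiff_pullbackCoeff o Ω hφ.1,
    SymplecticEnergy.toAlternatingMap_eq_hodgeStarTwo_smul o _, fun x => ?_, hloc, fun _ => ?_⟩,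
    fun ψ hψ h => hφ.energy_le o hψ h⟩
  · ext v
    simp only [SymplecticEnergy.coderivative, SymplecticEnergy.hodgeStarOne]
    rw [hd, neg_neg]
    rfl
  · have h0 : SymplecticEnergy.gradient (m := 2) (SymplecticEnergy.pullbackCoeff o Ω φ) x = 0 := by
      rw [SymplecticEnergy.gradient, hd]
      exact LinearIsometryEquiv.map_zero _
    rw [h0, norm_zero, zero_pow two_ne_zero, mul_zero]
  · obtain ⟨x⟩ := ‹ConnectedSpace M›.toNonempty
    exact ⟨_, fun y => hloc.apply_eq_of_preconnectedSpace y x⟩
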